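/- All graphs are finite, undirected, without loops or multiple edges. A matching of a graph $G$ is a set of edges no two of which share a vertex; $\nu(G)$ is the largest number of edges in a matching of $G$, and a matching is maximum if it has $\nu(G)$ edges. For a set $F$ of edges let $G\setminus F$ be the graph obtained from $G$ by removing the edges in $F$, and put \[ L(G)=\max\{\nu(G\setminus F): F \text{ is a maximum matching of } G\},\qquad l(G)=\min\{\nu(G\setminus F): F \text{ is a maximum matching of } G\}. \] The property $L(G)=2\,l(G)$ can be tested in polynomial time. Precisely: there are a program for a random access machine (with unit-cost addition, truncated subtraction, indirect memory access and jumps, but without multiplication) and a polynomial $p$ such that for every $n\ge 0$ and every graph $G$ on $n$ vertices, given by $n$ and its adjacency matrix, the program halts after at most $p(n)$ steps, with output $1$ if $L(G)=2\,l(G)$ and with output $0$ otherwise. -/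

import Mathlib

noncomputable section

/-! ### Matchings, `ν(G)`, `L(G)` and `l(G)` -/

namespace MatchingPairs

variable {V : Type*}

/-- A matching of `G`: a finite set of edges of `G`, no two of which share a vertex. -/
def IsMatching (G : SimpleGraph V) (M : Finset (Sym2 V)) : Prop :=
  (∀ e ∈ M, e ∈ G.edgeSet) ∧
    ∀ e ∈ M, ∀ f ∈ M, e ≠ f → ∀ v : V, ¬ (v ∈ e ∧ v ∈ f)

/-- `ν(G)`: the cardinality of a largest matching of `G`
(`V` is finite in all uses, so that the set is bounded; it contains `0`). -/
def matchingNumber (G : SimpleGraph V) : ℕ :=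
  sSup {k : ℕ | ∃ M : Finset (Sym2 V), IsMatching G M ∧ M.card = k}

/-- A maximum matching of `G`: a matching with `ν(G)` edges. -/
def IsMaximumMatching (G : SimpleGraph V) (F : Finset (Sym2 V)) : Prop :=
  IsMatching G F ∧ F.card = matchingNumber G

/-- The numbers `ν(G \ F)`, where `F` runs over the maximum matchings of `G`. -/
def residualMatchingNumbers (G : SimpleGraph V) : Set ℕ :=
  {k : ℕ | ∃ F : Finset (Sym2 V), IsMaximumMatching G F ∧
    matchingNumber (G.deleteEdges (F : Set (Sym2 V))) = k}

/-- `L(G) = max {ν(G \ F) : F a maximum matching of G}`. -/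
def bigL (G : SimpleGraph V) : ℕ := sSup (residualMatchingNumbers G)

/-- `l(G) = min {ν(G \ F) : F a maximum matching of G}`. -/
def smallL (G : SimpleGraph V) : ℕ := sInf (residualMatchingNumbers G)

end MatchingPairs

/-! ### Random access machines and polynomial time

The machine has registers `R 0, R 1, …`, of which a program can name only finitely many, and a
memory `M 0, M 1, …`, which is accessed only through an address held in a register. Every
instruction costs one step. There is no multiplication: in `t` steps the bit length of the numbers
grows by at most `t` plus a constant, so that polynomial time on this machine is the same as
polynomial time on a Turing machine. -/

namespace RAM

/-- The instructions. -/
inductive Instr where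
  /-- `R d := c` -/
  | const (d c : ℕ)
  /-- `R d := R a + R b` -/
  | add (d a b : ℕ)
  /-- `R d := max (R a - R b) 0` -/
  | sub (d a b : ℕ)
  /-- `R d := M (R a)` -/
  | load (d a : ℕ)
  /-- `M (R d) := R a` -/
  | store (d a : ℕ)
  /-- go to instruction `l` -/
  | jump (l : ℕ)
  /-- if `R a = 0`, go to instruction `l`, otherwise to the next instruction -/
  | jumpIfZero (a l : ℕ)

/-- A program is a finite list of instructions, numbered from `0`. -/
abbrev Program := List Instr

/-- A configuration: program counter, contents of the registers, contents of the memory. -/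
structure Config where
  pc : ℕ
  reg : ℕ → ℕ
  mem : ℕ → ℕ

/-- The effect of one instruction. -/
def exec (c : Config) : Instr → Config
  | .const d k => ⟨c.pc + 1, Function.update c.reg d k, c.mem⟩
  | .add d a b => ⟨c.pc + 1, Function.update c.reg d (c.reg a + c.reg b), c.mem⟩
  | .sub d a b => ⟨c.pc + 1, Function.update c.reg d (c.reg a - c.reg b), c.mem⟩
  | .load d a => ⟨c.pc + 1, Function.update c.reg d (c.mem (c.reg a)), c.mem⟩
  | .store d a => ⟨c.pc + 1, c.reg, Function.update c.mem (c.reg d) (c.reg a)⟩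
  | .jump l => ⟨l, c.reg, c.mem⟩
  | .jumpIfZero a l => ⟨if c.reg a = 0 then l else c.pc + 1, c.reg, c.mem⟩

/-- The machine halts when the program counter leaves the program. -/
def Halted (P : Program) (c : Config) : Prop := P.length ≤ c.pc

/-- One step of the machine; a halted configuration does not change any more. -/
def step (P : Program) (c : Config) : Config :=
  match P[c.pc]? with
  | none => c
  | some i => exec c i

/-- The configuration after `t` steps. -/
def run (P : Program) (t : ℕ) (c : Config) : Config := (step P)^[t] c

open Classical in
/-- The input for a graph `G` on the vertices `0, …, n - 1`: register `0` holds `n`, memory cell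
`i * n + j` with `i, j < n` holds the entry `(i, j)` of the adjacency matrix of `G`, and everything
else is `0`. -/
def input {n : ℕ} (G : SimpleGraph (Fin n)) : Config where
  pc := 0
  reg := fun r => if r = 0 then n else 0
  mem := fun a => if ∃ i j : Fin n, a = (i : ℕ) * n + (j : ℕ) ∧ G.Adj i j then 1 else 0

/-- On every graph, `P` halts after at most `T n` steps, where `n` is the number of vertices, with
`1` in register `0` if the graph has the property `Q`, and with `0` in register `0` if not. -/
def DecidesInTime (P : Program) (Q : ∀ n : ℕ, SimpleGraph (Fin n) → Prop) (T : ℕ → ℕ) : Prop :=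
  ∀ (n : ℕ) (G : SimpleGraph (Fin n)), ∃ t ≤ T n,
    Halted P (run P t (input G)) ∧
      (Q n G → (run P t (input G)).reg 0 = 1) ∧
      (¬ Q n G → (run P t (input G)).reg 0 = 0)

/-- The graph property `Q` can be tested in polynomial time: a single program decides it for all
graphs, in a number of steps bounded by a polynomial in the number of vertices. (As the input
consists of `n` and the `n ^ 2` entries of the adjacency matrix, this is the same as a polynomial in
the size of the input.) -/
def DecidableInPolyTime (Q : ∀ n : ℕ, SimpleGraph (Fin n) → Prop) : Prop :=
  ∃ (P : Program) (p : Polynomial ℕ), DecidesInTime P Q fun n => p.eval n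

end RAM

end

/-! Let `F'` be a maximum matching with a matching `H` of `L` edges outside it, and `F` a maximum
matching with `ν(G \ F) = l`. The edges of `H` inside `F` lie in `F \ F'`, which is as large as `F'
\ F`, a matching outside `F`. So `H ∩ F` and `H \ F` have at most `l` edges each, and `L ≤ 2l`.

In case of equality all these bounds are attained. Each edge of `F' \ F` then has one end `v` missed
by `F`, and `v` has two chosen neighbours, one through `F'` and one through `H`, such that all edges
of `F` at chosen neighbours are distinct (`exists_extremal`). Since no matching outside `F` has more
edges than there are such `v`, varying the choice of neighbours shows that any edge outside `F` that
avoids these `v` joins the two chosen neighbours of a single `v` (`Extremal.exists_eq_pair`). This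
makes `F` recognizable from degrees and triangles alone: it is the set of tight edges, and the
vertices `v` are the free ones (`Extremal.tight_iff`, `Extremal.free_iff`).

Hence `L = 2l` is equivalent to a first-order condition on `G` together with the existence of a
system of distinct tight edges, two for each free vertex (`bigL_eq_two_mul_smallL_iff`). For the
converse, the tight edges are a maximum matching that leaves at most as many disjoint edges as there
are free vertices, and exchanging along the system gives twice that number.

The first condition is checked by bounded quantifiers. The second is a bipartite matching problem,
solved by an auction in which idle bidders take a cheapest usable object and raise its price by one
(`Auction.iterate_sweep_iff`). If all can be served, prices never exceed the number of bidders, so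
quadratically many sweeps suffice. The algorithm is written in a language whose only loops run over
the numbers below `n`; its compiled code therefore takes polynomial time (`mainProgram_spec`). -/

namespace RAM

/-! ### A loop language and its compilation -/

/-- Expressions over named variables, the input size and the memory. -/
inductive Expr where
  /-- the input size `n` -/
  | size
  | var (x : ℕ)
  | const (c : ℕ)
  | add (a b : Expr)
  | sub (a b : Expr)
  /-- the memory cell with the given address -/
  | read (a : Expr)
  /-- `a` if `c = 0`, otherwise `b` -/
  | ifz (c a b : Expr)
  /-- the sum of `e` over all `x < n` -/
  | sum (x : ℕ) (e : Expr)

/-- Commands; they only change the memory. -/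
inductive Cmd where
  /-- assign the value of `e` to the memory cell `a` -/
  | store (a e : Expr)
  | seq (c d : Cmd)
  /-- execute `c` if `e ≠ 0` -/
  | when (e : Expr) (c : Cmd)
  /-- execute `c` for `x = 0, …, n - 1` -/
  | loop (x : ℕ) (c : Cmd)

/-- The value of an expression. -/
def Expr.eval (n : ℕ) (m : ℕ → ℕ) : Expr → (ℕ → ℕ) → ℕ
  | .size, _ => n
  | .var x, ρ => ρ x
  | .const c, _ => c
  | .add a b, ρ => a.eval n m ρ + b.eval n m ρ
  | .sub a b, ρ => a.eval n m ρ - b.eval n m ρ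
  | .read a, ρ => m (a.eval n m ρ)
  | .ifz c a b, ρ => if c.eval n m ρ = 0 then a.eval n m ρ else b.eval n m ρ
  | .sum x e, ρ => ∑ i ∈ Finset.range n, e.eval n m (Function.update ρ x i)

/-- The memory after the execution of a command. -/
def Cmd.eval (n : ℕ) : Cmd → (ℕ → ℕ) → (ℕ → ℕ) → (ℕ → ℕ)
  | .store a e, ρ, m => Function.update m (a.eval n m ρ) (e.eval n m ρ)
  | .seq c d, ρ, m => d.eval n ρ (c.eval n ρ m)
  | .when e c, ρ, m => if e.eval n m ρ = 0 then m else c.eval n ρ m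
  | .loop x c, ρ, m =>
      (List.range n).foldl (fun m i => c.eval n (Function.update ρ x i) m) m

/-- The register of a variable. -/
def vreg (x : ℕ) : ℕ := 2 * x + 2

/-- The register of a temporary value. -/
def treg (t : ℕ) : ℕ := 2 * t + 1

@[simp] lemma vreg_ne_treg (x t : ℕ) : vreg x ≠ treg t := by unfold vreg treg; omega
@[simp] lemma treg_ne_vreg (x t : ℕ) : treg t ≠ vreg x := by unfold vreg treg; omega
@[simp] lemma vreg_inj (x y : ℕ) : vreg x = vreg y ↔ x = y := by unfold vreg; omega
@[simp] lemma treg_inj (x y : ℕ) : treg x = treg y ↔ x = y := by unfold treg; omega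
@[simp] lemma zero_ne_vreg (x : ℕ) : 0 ≠ vreg x := by unfold vreg; omega
@[simp] lemma zero_ne_treg (x : ℕ) : 0 ≠ treg x := by unfold treg; omega

/-- Code at address `k` that executes `B` for all values of the variable `x` below the input size,
using the temporaries `t` and `t + 1`. -/
def loopCode (k x t : ℕ) (B : List Instr) : List Instr :=
  [.const (treg t) 0, .add (treg t) (treg t) (vreg x), .const (vreg x) 0,
    .sub (treg (t + 1)) 0 (vreg x), .jumpIfZero (treg (t + 1)) (k + 5 + B.length + 3)] ++ (B ++
  [.const (treg (t + 1)) 1, .add (vreg x) (vreg x) (treg (t + 1)), .jump (k + 3),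
    .const (vreg x) 0, .add (vreg x) (vreg x) (treg t)])

/-- Code at address `k` that puts the value of an expression into the temporary `t`. -/
def Expr.compile : Expr → ℕ → ℕ → List Instr
  | .size, _, t => [.const (treg t) 0, .add (treg t) (treg t) 0]
  | .var x, _, t => [.const (treg t) 0, .add (treg t) (treg t) (vreg x)]
  | .const c, _, t => [.const (treg t) c]
  | .add a b, k, t =>
      a.compile k t ++ (b.compile (k + (a.compile k t).length) (t + 1) ++
        [.add (treg t) (treg t) (treg (t + 1))])
  | .sub a b, k, t =>
      a.compile k t ++ (b.compile (k + (a.compile k t).length) (t + 1) ++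
        [.sub (treg t) (treg t) (treg (t + 1))])
  | .read a, k, t => a.compile k t ++ [.load (treg t) (treg t)]
  | .ifz c a b, k, t =>
      let C := c.compile k t
      let B := b.compile (k + C.length + 1) t
      let A := a.compile (k + C.length + 1 + B.length + 1) t
      C ++ (.jumpIfZero (treg t) (k + C.length + 1 + B.length + 1) ::
        (B ++ (.jump (k + C.length + 1 + B.length + 1 + A.length) :: A)))
  | .sum x e, k, t =>
      .const (treg t) 0 :: loopCode (k + 1) x (t + 1)
        (e.compile (k + 6) (t + 2) ++ [.add (treg t) (treg t) (treg (t + 2))])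

/-- Code at address `k` that executes a command, using only temporaries from `t` on. -/
def Cmd.compile : Cmd → ℕ → ℕ → List Instr
  | .store a e, k, t =>
      a.compile k t ++ (e.compile (k + (a.compile k t).length) (t + 1) ++
        [.store (treg t) (treg (t + 1))])
  | .seq c d, k, t => c.compile k t ++ d.compile (k + (c.compile k t).length) t
  | .when e c, k, t =>
      let E := e.compile k t
      let C := c.compile (k + E.length + 1) t
      E ++ (.jumpIfZero (treg t) (k + E.length + 1 + C.length) :: C)
  | .loop x c, k, t => loopCode k x t (c.compile (k + 5) (t + 2))

open Polynomial in
/-- A bound for the number of steps of the compiled expression. -/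
noncomputable def Expr.cost : Expr → Polynomial ℕ
  | .size => 2
  | .var _ => 2
  | .const _ => 1
  | .add a b => a.cost + b.cost + 1
  | .sub a b => a.cost + b.cost + 1
  | .read a => a.cost + 1
  | .ifz c a b => c.cost + a.cost + b.cost + 2
  | .sum _ e => X * (e.cost + 6) + 8

open Polynomial in
/-- A bound for the number of steps of the compiled command. -/
noncomputable def Cmd.cost : Cmd → Polynomial ℕ
  | .store a e => a.cost + e.cost + 1
  | .seq c d => c.cost + d.cost
  | .when e c => e.cost + c.cost + 1
  | .loop _ c => X * (c.cost + 5) + 7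

/-! ### Correctness and running time of the compiled code -/

/-- The instructions `l` stand at address `k` of `P`. -/
def Seg (P : Program) : ℕ → List Instr → Prop
  | _, [] => True
  | k, i :: l => P[k]? = some i ∧ Seg P (k + 1) l

@[simp] lemma Seg_nil (P : Program) (k : ℕ) : Seg P k [] := trivial

@[simp] lemma Seg_cons (P : Program) (k : ℕ) (i : Instr) (l : List Instr) :
    Seg P k (i :: l) ↔ P[k]? = some i ∧ Seg P (k + 1) l := Iff.rfl

@[simp] lemma Seg_append (P : Program) (k : ℕ) (l l' : List Instr) :
    Seg P k (l ++ l') ↔ Seg P k l ∧ Seg P (k + l.length) l' := by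
  induction l generalizing k with
  | nil => simp
  | cons i l ih =>
    simp only [List.cons_append, Seg_cons, ih, List.length_cons, and_assoc]
    rw [show k + 1 + l.length = k + (l.length + 1) by omega]

lemma Seg_of_append (l l' : List Instr) : Seg (l ++ l') l.length l' := by
  induction l' generalizing l with
  | nil => simp
  | cons i l' ih =>
    refine ⟨by simp, ?_⟩
    have := ih (l ++ [i])
    simpa using this

lemma Seg_self (P : Program) : Seg P 0 P := Seg_of_append [] P

/-- `P` takes the configuration `c` to `c'` in at most `T` steps. -/
def Reaches (P : Program) (T : ℕ) (c c' : Config) : Prop := ∃ t ≤ T, run P t c = c'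

lemma Reaches.refl (P : Program) (T : ℕ) (c : Config) : Reaches P T c c := ⟨0, Nat.zero_le _, rfl⟩

lemma Reaches.trans {P : Program} {T T' : ℕ} {c c' c'' : Config} (h : Reaches P T c c')
    (h' : Reaches P T' c' c'') : Reaches P (T + T') c c'' := by
  obtain ⟨t, ht, rfl⟩ := h
  obtain ⟨s, hs, rfl⟩ := h'
  refine ⟨s + t, by omega, ?_⟩
  simp [run, Function.iterate_add_apply]

lemma Reaches.mono {P : Program} {T T' : ℕ} {c c' : Config} (h : Reaches P T c c')
    (hT : T ≤ T') : Reaches P T' c c' := by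
  obtain ⟨t, ht, e⟩ := h
  exact ⟨t, ht.trans hT, e⟩

lemma Reaches.head {P : Program} {T : ℕ} {c c' : Config} {i : Instr} (hi : P[c.pc]? = some i)
    (h : Reaches P T (exec c i) c') : Reaches P (T + 1) c c' := by
  obtain ⟨t, ht, rfl⟩ := h
  refine ⟨t + 1, by omega, ?_⟩
  simp [run, Function.iterate_succ_apply, step, hi]

/-- The registers `r` hold the input size `n` and the values `ρ` of the variables. -/
def Agrees (n : ℕ) (ρ r : ℕ → ℕ) : Prop := r 0 = n ∧ ∀ x, r (vreg x) = ρ x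

lemma Agrees.update_treg {n : ℕ} {ρ r : ℕ → ℕ} (h : Agrees n ρ r) (t v : ℕ) :
    Agrees n ρ (Function.update r (treg t) v) := by
  simpa [Agrees, Function.update_apply] using h

lemma Agrees.update_vreg {n : ℕ} {ρ r : ℕ → ℕ} (h : Agrees n ρ r) (x v : ℕ) :
    Agrees n (Function.update ρ x v) (Function.update r (vreg x) v) := by
  refine ⟨by simpa [Function.update_apply] using h.1, fun y => ?_⟩
  simp only [Function.update_apply, vreg_inj, h.2]

/-- `r` and `r'` have the same temporaries below `t`. -/
def SameBelow (t : ℕ) (r r' : ℕ → ℕ) : Prop := ∀ s < t, r' (treg s) = r (treg s)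

lemma SameBelow.refl (t : ℕ) (r : ℕ → ℕ) : SameBelow t r r := fun _ _ => rfl

lemma SameBelow.trans {t : ℕ} {r r' r'' : ℕ → ℕ} (h : SameBelow t r r') (h' : SameBelow t r' r'') :
    SameBelow t r r'' := fun s hs => (h' s hs).trans (h s hs)

lemma SameBelow.mono {t t' : ℕ} {r r' : ℕ → ℕ} (h : SameBelow t r r') (ht : t' ≤ t) :
    SameBelow t' r r' := fun s hs => h s (by omega)

lemma SameBelow.update_treg {t : ℕ} {r r' : ℕ → ℕ} (h : SameBelow t r r') (s v : ℕ) (hs : t ≤ s) :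
    SameBelow t r (Function.update r' (treg s) v) := fun u hu => by
  rw [Function.update_of_ne (by simp; omega), h u hu]

lemma SameBelow.update_vreg {t : ℕ} {r r' : ℕ → ℕ} (h : SameBelow t r r') (x v : ℕ) :
    SameBelow t r (Function.update r' (vreg x) v) := fun u hu => by
  rw [Function.update_of_ne (by simp), h u hu]

/-- Induction on the number `j` of remaining rounds, entering at the loop test. A round costs two
instructions for the test and three for the increment and the jump back. The invariant may look at
no register except temporaries below `t`, since the loop changes the others; the body must keep the
temporary `t`, where the old value of `x` is saved. -/
lemma loopCode_iterations {P : Program} {n k x t T : ℕ} {B : List Instr} {ρ : ℕ → ℕ}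
    (hP : Seg P k (loopCode k x t B)) (Inv : ℕ → (ℕ → ℕ) → (ℕ → ℕ) → Prop)
    (hInv : ∀ i r r' m, SameBelow t r r' → Inv i r m → Inv i r' m)
    (hB : ∀ i < n, ∀ r m, Agrees n (Function.update ρ x i) r → Inv i r m →
      ∃ r' m', Reaches P T ⟨k + 5, r, m⟩ ⟨k + 5 + B.length, r', m'⟩ ∧
        Agrees n (Function.update ρ x i) r' ∧ Inv (i + 1) r' m' ∧ r' (treg t) = r (treg t))
    (j : ℕ) : ∀ i, i + j = n → ∀ r m, Agrees n (Function.update ρ x i) r → Inv i r m →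
      ∃ r' m', Reaches P (j * (T + 5) + 2) ⟨k + 3, r, m⟩ ⟨k + 5 + B.length + 3, r', m'⟩ ∧
        Agrees n (Function.update ρ x n) r' ∧ Inv n r' m' ∧ r' (treg t) = r (treg t) := by
  simp only [loopCode, Seg_append, Seg_cons, List.length_cons, List.length_nil] at hP
  obtain ⟨⟨-, -, -, h3, h4, -⟩, -, h5, h6, h7, -⟩ := hP
  simp only [zero_add, Nat.reduceAdd, add_assoc] at h3 h4 h5 h6 h7
  have key : ∀ i r m, Agrees n (Function.update ρ x i) r → Inv i r m →
      Agrees n (Function.update ρ x i) (Function.update r (treg (t + 1)) (n - i)) ∧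
      Inv i (Function.update r (treg (t + 1)) (n - i)) m ∧
      exec ⟨k + 3, r, m⟩ (.sub (treg (t + 1)) 0 (vreg x)) =
        ⟨k + 4, Function.update r (treg (t + 1)) (n - i), m⟩ := by
    intro i r m hr hI
    refine ⟨hr.update_treg _ _, hInv _ _ _ _ ((SameBelow.refl _ _).update_treg _ _ (by omega)) hI,
      ?_⟩
    simp [exec, hr.1, hr.2]
  induction j with
  | zero =>
    intro i hi r m hr hI
    obtain rfl : i = n := by omega
    obtain ⟨hr1, hI1, e1⟩ := key i r m hr hI
    refine ⟨_, m, ?_, hr1, hI1, by simp⟩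
    refine Reaches.mono (T := 0 + 1 + 1) ?_ (by omega)
    refine Reaches.head h3 ?_
    rw [e1]
    refine Reaches.head h4 ?_
    simp only [exec, Function.update_self, Nat.sub_self, if_true]
    simp only [add_assoc]
    exact Reaches.refl _ _ _
  | succ j ih =>
    intro i hi r m hr hI
    obtain ⟨hr1, hI1, e1⟩ := key i r m hr hI
    obtain ⟨r2, m2, hR2, hr2, hI2, ht2⟩ := hB i (by omega) _ _ hr1 hI1
    have hr3 : Agrees n (Function.update ρ x (i + 1))
        (Function.update (Function.update r2 (treg (t + 1)) 1) (vreg x) (i + 1)) := by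
      have := (hr2.update_treg (t + 1) 1).update_vreg x (i + 1)
      simpa using this
    obtain ⟨r', m', hR', h1', h2', h3'⟩ := ih (i + 1) (by omega) _ m2 hr3
      (hInv _ _ _ _ (((SameBelow.refl _ _).update_treg _ _ (by omega)).update_vreg _ _) hI2)
    refine ⟨r', m', ?_, h1', h2', ?_⟩
    · refine Reaches.mono (T := (T + (j * (T + 5) + 2 + 1 + 1 + 1)) + 1 + 1) ?_
        (by rw [Nat.succ_mul]; omega)
      refine Reaches.head h3 ?_
      rw [e1]
      refine Reaches.head h4 ?_
      have : n - i ≠ 0 := by omega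
      simp only [exec, Function.update_self, this, if_false]
      refine hR2.trans ?_
      refine Reaches.head (by simpa [add_assoc, add_comm, add_left_comm] using h5) ?_
      refine Reaches.head (by simpa [exec, add_assoc, add_comm, add_left_comm] using h6) ?_
      refine Reaches.head (by simpa [exec, add_assoc, add_comm, add_left_comm] using h7) ?_
      have e : r2 (vreg x) = i := by simp [hr2.2]
      simpa [exec, e] using hR'
    · simp [h3', ht2]

/-- The extra `7` steps are three to save and reset `x`, two for the last test and two to restore
`x`. -/
lemma loopCode_spec {P : Program} {n k x t T : ℕ} {B : List Instr} {ρ : ℕ → ℕ}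
    (hP : Seg P k (loopCode k x t B)) (Inv : ℕ → (ℕ → ℕ) → (ℕ → ℕ) → Prop)
    (hInv : ∀ i r r' m, SameBelow t r r' → Inv i r m → Inv i r' m)
    (hB : ∀ i < n, ∀ r m, Agrees n (Function.update ρ x i) r → Inv i r m →
      ∃ r' m', Reaches P T ⟨k + 5, r, m⟩ ⟨k + 5 + B.length, r', m'⟩ ∧
        Agrees n (Function.update ρ x i) r' ∧ Inv (i + 1) r' m' ∧ r' (treg t) = r (treg t))
    (r m : ℕ → ℕ) (hr : Agrees n ρ r) (hI : Inv 0 r m) :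
    ∃ r' m', Reaches P (n * (T + 5) + 7) ⟨k, r, m⟩ ⟨k + (loopCode k x t B).length, r', m'⟩ ∧
      Agrees n ρ r' ∧ Inv n r' m' := by
  have hP' := hP
  simp only [loopCode, Seg_append, Seg_cons, List.length_cons, List.length_nil] at hP
  obtain ⟨⟨h0, h1, h2, -⟩, -, -, -, -, h8, h9, -⟩ := hP
  simp only [zero_add, Nat.reduceAdd, add_assoc] at h0 h1 h2 h8 h9
  set r3 := Function.update (Function.update (Function.update r (treg t) 0) (treg t) (ρ x))
    (vreg x) 0 with hr3
  have hr3' : Agrees n (Function.update ρ x 0) r3 :=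
    ((hr.update_treg t 0).update_treg t (ρ x)).update_vreg x 0
  obtain ⟨r', m', hR, ha, hI', ht⟩ := loopCode_iterations hP' Inv hInv hB n 0 (by omega) r3 m hr3'
    (hInv _ _ _ _ ((((SameBelow.refl _ _).update_treg _ _ le_rfl).update_treg _ _
      le_rfl).update_vreg _ _) hI)
  refine ⟨Function.update (Function.update r' (vreg x) 0) (vreg x) (ρ x), m', ?_, ?_, ?_⟩
  · refine Reaches.mono (T := ((n * (T + 5) + 2) + (0 + 1 + 1)) + 1 + 1 + 1) ?_ (by omega)
    refine Reaches.head h0 ?_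
    refine Reaches.head (by simpa [exec] using h1) ?_
    refine Reaches.head (by simpa [exec, add_assoc] using h2) ?_
    have e : exec (exec (exec ⟨k, r, m⟩ (.const (treg t) 0)) (.add (treg t) (treg t) (vreg x)))
        (.const (vreg x) 0) = ⟨k + 3, r3, m⟩ := by
      simp [exec, hr3, hr.2]
    rw [e]
    refine Reaches.trans (T' := 0 + 1 + 1) hR ?_
    refine Reaches.head (by simpa [exec, add_assoc, add_comm, add_left_comm] using h8) ?_
    refine Reaches.head (by simpa [exec, add_assoc, add_comm, add_left_comm] using h9) ?_
    have e2 : r' (treg t) = ρ x := by simp [ht, hr3]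
    have e3 : k + 5 + B.length + 3 + 1 + 1 = k + (loopCode k x t B).length := by
      simp [loopCode]; omega
    simp only [exec, e3]
    simp only [Function.update_self, zero_add, ne_eq, treg_ne_vreg, not_false_eq_true,
      Function.update_of_ne, e2]
    exact Reaches.refl _ _ _
  · have := (ha.update_vreg x 0).update_vreg x (ρ x)
    simpa using this
  · exact hInv _ _ _ _ (((SameBelow.refl _ _).update_vreg _ _).update_vreg _ _) hI'

/-- The temporaries act as a stack: code at level `t` leaves those below `t` alone, so the left
operand survives in `t` while the right one is evaluated into `t + 1`. -/
lemma Expr.compile_spec {P : Program} {n : ℕ} {m : ℕ → ℕ} (e : Expr) :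
    ∀ {k t : ℕ} {ρ r : ℕ → ℕ}, Seg P k (e.compile k t) → Agrees n ρ r →
      ∃ r', Reaches P (e.cost.eval n) ⟨k, r, m⟩ ⟨k + (e.compile k t).length, r', m⟩ ∧
        Agrees n ρ r' ∧ SameBelow t r r' ∧ r' (treg t) = e.eval n m ρ := by
  induction e with
  | size =>
    intro k t ρ r hP hr
    refine ⟨_, ?_, (hr.update_treg t 0).update_treg t n,
      ((SameBelow.refl _ _).update_treg _ _ le_rfl).update_treg _ _ le_rfl, by simp [eval]⟩
    refine Reaches.mono (T := 0 + 1 + 1) ?_ (by simp [cost])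
    refine Reaches.head hP.1 (Reaches.head hP.2.1 ?_)
    simp [exec, hr.1, compile, Reaches.refl, add_assoc]
  | var x =>
    intro k t ρ r hP hr
    refine ⟨_, ?_, (hr.update_treg t 0).update_treg t (ρ x),
      ((SameBelow.refl _ _).update_treg _ _ le_rfl).update_treg _ _ le_rfl, by simp [eval]⟩
    refine Reaches.mono (T := 0 + 1 + 1) ?_ (by simp [cost])
    refine Reaches.head hP.1 (Reaches.head hP.2.1 ?_)
    simp [exec, hr.2, compile, Reaches.refl, add_assoc]
  | const c =>
    intro k t ρ r hP hr
    refine ⟨_, ?_, hr.update_treg t c, (SameBelow.refl _ _).update_treg _ _ le_rfl, by simp [eval]⟩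
    refine Reaches.mono (T := 0 + 1) ?_ (by simp [cost])
    refine Reaches.head hP.1 ?_
    simp [exec, compile, Reaches.refl]
  | add a b iha ihb =>
    intro k t ρ r hP hr
    simp only [compile, Seg_append, Seg_cons] at hP
    obtain ⟨ha, hb, hi, -⟩ := hP
    obtain ⟨r1, hR1, hr1, hs1, hv1⟩ := iha ha hr
    obtain ⟨r2, hR2, hr2, hs2, hv2⟩ := ihb hb hr1
    refine ⟨_, ?_, hr2.update_treg t (a.eval n m ρ + b.eval n m ρ),
      (hs1.trans (hs2.mono (by omega))).update_treg _ _ le_rfl, by simp [eval]⟩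
    refine Reaches.mono (T := a.cost.eval n + (b.cost.eval n + (0 + 1))) ?_ (by simp [cost]; omega)
    refine hR1.trans (hR2.trans (Reaches.head hi ?_))
    simp [exec, hv2, hs2 t (by omega), hv1, compile, Reaches.refl, add_assoc]
  | sub a b iha ihb =>
    intro k t ρ r hP hr
    simp only [compile, Seg_append, Seg_cons] at hP
    obtain ⟨ha, hb, hi, -⟩ := hP
    obtain ⟨r1, hR1, hr1, hs1, hv1⟩ := iha ha hr
    obtain ⟨r2, hR2, hr2, hs2, hv2⟩ := ihb hb hr1
    refine ⟨_, ?_, hr2.update_treg t (a.eval n m ρ - b.eval n m ρ),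
      (hs1.trans (hs2.mono (by omega))).update_treg _ _ le_rfl, by simp [eval]⟩
    refine Reaches.mono (T := a.cost.eval n + (b.cost.eval n + (0 + 1))) ?_ (by simp [cost]; omega)
    refine hR1.trans (hR2.trans (Reaches.head hi ?_))
    simp [exec, hv2, hs2 t (by omega), hv1, compile, Reaches.refl, add_assoc]
  | read a iha =>
    intro k t ρ r hP hr
    simp only [compile, Seg_append, Seg_cons] at hP
    obtain ⟨ha, hi, -⟩ := hP
    obtain ⟨r1, hR1, hr1, hs1, hv1⟩ := iha ha hr
    refine ⟨_, ?_, hr1.update_treg t (m (a.eval n m ρ)), hs1.update_treg _ _ le_rfl, by simp [eval]⟩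
    refine Reaches.mono (T := a.cost.eval n + (0 + 1)) ?_ (by simp [cost])
    refine hR1.trans (Reaches.head hi ?_)
    simp [exec, hv1, compile, Reaches.refl, add_assoc]
  | ifz c a b ihc iha ihb =>
    intro k t ρ r hP hr
    simp only [compile, Seg_append, Seg_cons] at hP
    obtain ⟨hc, hj, hb, hj', ha⟩ := hP
    obtain ⟨r1, hR1, hr1, hs1, hv1⟩ := ihc hc hr
    by_cases h : c.eval n m ρ = 0
    · obtain ⟨r2, hR2, hr2, hs2, hv2⟩ := iha ha hr1
      refine ⟨r2, ?_, hr2, hs1.trans hs2, by simp [eval, h, hv2]⟩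
      refine Reaches.mono (T := c.cost.eval n + (a.cost.eval n + 1)) ?_ (by simp [cost]; omega)
      refine hR1.trans (Reaches.head hj ?_)
      simp only [exec, hv1, h, if_true]
      convert hR2 using 2
      simp [compile]; omega
    · obtain ⟨r2, hR2, hr2, hs2, hv2⟩ := ihb hb hr1
      refine ⟨r2, ?_, hr2, hs1.trans hs2, by simp [eval, h, hv2]⟩
      refine Reaches.mono (T := c.cost.eval n + ((b.cost.eval n + (0 + 1)) + 1)) ?_
        (by simp [cost]; omega)
      refine hR1.trans (Reaches.head hj ?_)
      simp only [exec, hv1, h, if_false]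
      refine hR2.trans (Reaches.head hj' ?_)
      simp only [exec]
      convert Reaches.refl _ _ _ using 2
      simp [compile]; omega
  | sum x e ih =>
    intro k t ρ r hP hr
    simp only [compile, Seg_cons] at hP
    obtain ⟨h0, hL⟩ := hP
    have hL' := hL
    simp only [loopCode, Seg_append, Seg_cons, List.length_cons, List.length_nil] at hL'
    obtain ⟨-, ⟨he, hi, -⟩, -⟩ := hL'
    simp only [zero_add, Nat.reduceAdd, add_assoc] at he hi
    -- The temporary `t` accumulates the partial sum. The loop runs at level `t + 1`, and its test
    -- register `t + 2` is free for the summand during the body.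
    obtain ⟨r', m', hR, hr', ⟨rfl, hs, hv⟩⟩ := loopCode_spec (T := e.cost.eval n + 1) hL
      (fun i r' m' => m' = m ∧ SameBelow t r r' ∧
        r' (treg t) = ∑ j ∈ Finset.range i, e.eval n m (Function.update ρ x j))
      (by
        rintro i r1 r2 m' h ⟨rfl, h1, h2⟩
        exact ⟨rfl, h1.trans (h.mono (by omega)), by rw [h t (by omega), h2]⟩)
      (by
        rintro i hin r1 m' hr1 ⟨rfl, hs1, hv1⟩
        obtain ⟨r2, hR2, hr2, hs2, hv2⟩ := ih he hr1
        refine ⟨_, m', ?_, hr2.update_treg t (r1 (treg t) + e.eval n m' (Function.update ρ x i)),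
          ⟨rfl, (hs1.trans (hs2.mono (by omega))).update_treg _ _ le_rfl, ?_⟩, ?_⟩
        · refine Reaches.trans (T' := 0 + 1)
            (by simpa [add_assoc, add_comm, add_left_comm] using hR2) (Reaches.head hi ?_)
          simp [exec, hv2, hs2 t (by omega), Reaches.refl, add_assoc, add_comm, add_left_comm]
        · simp [Finset.sum_range_succ, hv1]
        · rw [Function.update_of_ne (by simp), hs2 (t + 1) (by omega)])
      (Function.update r (treg t) 0) m (hr.update_treg t 0)
      ⟨rfl, (SameBelow.refl _ _).update_treg _ _ le_rfl, by simp⟩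
    refine ⟨r', ?_, hr', hs, by simp [eval, hv]⟩
    refine Reaches.mono (T := n * (e.cost.eval n + 1 + 5) + 7 + 1) (Reaches.head h0 ?_)
      (by simp [cost, add_assoc])
    simpa [exec, compile, add_assoc, add_comm, add_left_comm] using hR

lemma Cmd.compile_spec {P : Program} {n : ℕ} (c : Cmd) :
    ∀ {k t : ℕ} {ρ r m : ℕ → ℕ}, Seg P k (c.compile k t) → Agrees n ρ r →
      ∃ r', Reaches P (c.cost.eval n) ⟨k, r, m⟩ ⟨k + (c.compile k t).length, r', c.eval n ρ m⟩ ∧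
        Agrees n ρ r' ∧ SameBelow t r r' := by
  induction c with
  | store a e =>
    intro k t ρ r m hP hr
    simp only [compile, Seg_append, Seg_cons] at hP
    obtain ⟨ha, he, hi, -⟩ := hP
    obtain ⟨r1, hR1, hr1, hs1, hv1⟩ := a.compile_spec (m := m) ha hr
    obtain ⟨r2, hR2, hr2, hs2, hv2⟩ := e.compile_spec (m := m) he hr1
    refine ⟨r2, ?_, hr2, hs1.trans (hs2.mono (by omega))⟩
    refine Reaches.mono (T := a.cost.eval n + (e.cost.eval n + (0 + 1))) ?_ (by simp [cost]; omega)
    refine hR1.trans (hR2.trans (Reaches.head hi ?_))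
    simp [exec, hv2, hs2 t (by omega), hv1, compile, eval, Reaches.refl, add_assoc]
  | seq c d ihc ihd =>
    intro k t ρ r m hP hr
    simp only [compile, Seg_append] at hP
    obtain ⟨hc, hd⟩ := hP
    obtain ⟨r1, hR1, hr1, hs1⟩ := ihc (m := m) hc hr
    obtain ⟨r2, hR2, hr2, hs2⟩ := ihd (m := c.eval n ρ m) hd hr1
    refine ⟨r2, ?_, hr2, hs1.trans hs2⟩
    simpa [cost, compile, eval, add_assoc] using hR1.trans hR2
  | when e c ih =>
    intro k t ρ r m hP hr
    simp only [compile, Seg_append, Seg_cons] at hP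
    obtain ⟨he, hj, hc⟩ := hP
    obtain ⟨r1, hR1, hr1, hs1, hv1⟩ := e.compile_spec (m := m) he hr
    by_cases h : e.eval n m ρ = 0
    · refine ⟨r1, ?_, hr1, hs1⟩
      refine Reaches.mono (T := e.cost.eval n + (0 + 1)) ?_ (by simp [cost])
      refine hR1.trans (Reaches.head hj ?_)
      simp only [exec, hv1, h, if_true, eval]
      convert Reaches.refl _ _ _ using 2
      simp [compile]; omega
    · obtain ⟨r2, hR2, hr2, hs2⟩ := ih (m := m) hc hr1
      refine ⟨r2, ?_, hr2, hs1.trans hs2⟩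
      refine Reaches.mono (T := e.cost.eval n + (c.cost.eval n + 1)) ?_ (by simp [cost]; omega)
      refine hR1.trans (Reaches.head hj ?_)
      simp only [exec, hv1, h, if_false, eval]
      convert hR2 using 2
      simp [compile]; omega
  | loop x c ih =>
    intro k t ρ r m hP hr
    have hL := hP
    simp only [compile] at hL
    have hL' := hL
    simp only [loopCode, Seg_append, Seg_cons, List.length_cons, List.length_nil] at hL'
    obtain ⟨-, hc, -⟩ := hL'
    simp only [zero_add, Nat.reduceAdd] at hc
    obtain ⟨r', m', hR, hr', ⟨rfl, hs⟩⟩ := loopCode_spec (T := c.cost.eval n) hL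
      (fun i r' m' => m' = (List.range i).foldl
        (fun m i => c.eval n (Function.update ρ x i) m) m ∧ SameBelow t r r')
      (by
        rintro i r1 r2 m' h ⟨rfl, h1⟩
        exact ⟨rfl, h1.trans h⟩)
      (by
        rintro i hin r1 m' hr1 ⟨rfl, hs1⟩
        obtain ⟨r2, hR2, hr2, hs2⟩ := ih (m := (List.range i).foldl
          (fun m i => c.eval n (Function.update ρ x i) m) m) hc hr1
        refine ⟨r2, _, hR2, hr2, ⟨?_, hs1.trans (hs2.mono (by omega))⟩, hs2 t (by omega)⟩
        simp [List.range_succ])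
      r m hr ⟨by simp, SameBelow.refl _ _⟩
    refine ⟨r', ?_, hr', hs⟩
    simpa [cost, compile, eval] using hR

/-- The program that executes `c` and outputs the value of `e`. -/
def mainProgram (c : Cmd) (e : Expr) : Program :=
  let C := c.compile 0 0
  C ++ (e.compile C.length 0 ++ [.const 0 0, .add 0 0 (treg 0)])

lemma mainProgram_spec (c : Cmd) (e : Expr) {n : ℕ} (G : SimpleGraph (Fin n)) :
    ∃ t ≤ (c.cost + e.cost + 2).eval n,
      Halted (mainProgram c e) (run (mainProgram c e) t (input G)) ∧
      (run (mainProgram c e) t (input G)).reg 0 =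
        e.eval n (c.eval n (fun _ => 0) (input G).mem) (fun _ => 0) := by
  have hP := Seg_self (mainProgram c e)
  rw [show Seg (mainProgram c e) 0 (mainProgram c e) =
    Seg (mainProgram c e) 0 (c.compile 0 0 ++ (e.compile (c.compile 0 0).length 0 ++
      [.const 0 0, .add 0 0 (treg 0)])) from rfl] at hP
  simp only [Seg_append, Seg_cons, zero_add] at hP
  obtain ⟨hc, he, h0, h1, -⟩ := hP
  have hr : Agrees n (fun _ => 0) (input G).reg :=
    ⟨by simp [input], fun x => by simp [input, vreg]⟩
  obtain ⟨r1, hR1, hr1, -⟩ := c.compile_spec (m := (input G).mem) hc hr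
  rw [zero_add] at hR1
  obtain ⟨r2, hR2, hr2, -, hv⟩ := e.compile_spec
    (m := c.eval n (fun _ => 0) (input G).mem) he hr1
  -- The input size is no longer needed at this point, so register `0` may receive the output.
  have hR : Reaches (mainProgram c e) (c.cost.eval n + (e.cost.eval n + (0 + 1 + 1))) (input G) _ :=
    hR1.trans (hR2.trans (Reaches.head h0 (Reaches.head h1 (Reaches.refl _ _ _))))
  obtain ⟨t, ht, ht'⟩ := hR
  refine ⟨t, ht.trans (by simp; omega), ?_, ?_⟩
  · rw [ht']
    simp [Halted, exec, mainProgram]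
    omega
  · rw [ht']
    simp only [exec, Function.update_self, zero_add]
    rw [Function.update_of_ne (by simp [treg]), hv]

end RAM

namespace MatchingPairs

/-! ### Basic facts about matchings -/

variable {V : Type*}

lemma IsMatching.eq_of_mem {G : SimpleGraph V} {M : Finset (Sym2 V)} (h : IsMatching G M)
    {e f : Sym2 V} (he : e ∈ M) (hf : f ∈ M) {v : V} (hve : v ∈ e) (hvf : v ∈ f) : e = f := by
  by_contra hne
  exact h.2 e he f hf hne v ⟨hve, hvf⟩

lemma IsMatching.right_unique {G : SimpleGraph V} {M : Finset (Sym2 V)} (h : IsMatching G M)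
    {a b c : V} (hb : s(a, b) ∈ M) (hc : s(a, c) ∈ M) : b = c := by
  have := h.eq_of_mem hb hc (Sym2.mem_mk_left a b) (Sym2.mem_mk_left a c)
  exact Sym2.congr_right.1 this

lemma IsMatching.subset {G : SimpleGraph V} {M N : Finset (Sym2 V)} (h : IsMatching G M)
    (hN : N ⊆ M) : IsMatching G N :=
  ⟨fun e he => h.1 e (hN he), fun e he f hf => h.2 e (hN he) f (hN hf)⟩

lemma isMatching_empty (G : SimpleGraph V) : IsMatching G ∅ := by simp [IsMatching]

lemma IsMatching.insert [DecidableEq V] {G : SimpleGraph V} {M : Finset (Sym2 V)}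
    (h : IsMatching G M) {e : Sym2 V} (he : e ∈ G.edgeSet)
    (hd : ∀ f ∈ M, ∀ v, v ∈ e → v ∉ f) : IsMatching G (insert e M) := by
  refine ⟨by simpa [he] using h.1, ?_⟩
  intro f hf g hg hne v hv
  rw [Finset.mem_insert] at hf hg
  rcases hf with rfl | hf <;> rcases hg with rfl | hg
  · exact hne rfl
  · exact hd g hg v hv.1 hv.2
  · exact hd f hf v hv.2 hv.1
  · exact h.2 f hf g hg hne v hv

lemma IsMatching.union [DecidableEq V] {G : SimpleGraph V} {M N : Finset (Sym2 V)}
    (hM : IsMatching G M) (hN : IsMatching G N) (hd : ∀ e ∈ M, ∀ f ∈ N, ∀ v, v ∈ e → v ∉ f) :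
    IsMatching G (M ∪ N) := by
  refine ⟨fun e he => (Finset.mem_union.1 he).elim (hM.1 e) (hN.1 e), ?_⟩
  intro e he f hf hne v hv
  rcases Finset.mem_union.1 he with he | he <;> rcases Finset.mem_union.1 hf with hf | hf
  · exact hM.2 e he f hf hne v hv
  · exact hd e he f hf v hv.1 hv.2
  · exact hd f hf e he v hv.2 hv.1
  · exact hN.2 e he f hf hne v hv

lemma isMatching_deleteEdges {G : SimpleGraph V} {F M : Finset (Sym2 V)} :
    IsMatching (G.deleteEdges (F : Set (Sym2 V))) M ↔ IsMatching G M ∧ ∀ e ∈ M, e ∉ F := by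
  simp only [IsMatching, SimpleGraph.edgeSet_deleteEdges, Set.mem_sdiff, Finset.mem_coe]
  grind

/-- The edges `v (f v)`, for `v` in `Y`. -/
def starEdges [DecidableEq V] (Y : Finset V) (f : V → V) : Finset (Sym2 V) :=
  Y.image fun v => s(v, f v)

lemma mem_starEdges [DecidableEq V] {Y : Finset V} {f : V → V} {e : Sym2 V} :
    e ∈ starEdges Y f ↔ ∃ v ∈ Y, s(v, f v) = e := by simp [starEdges]

lemma card_starEdges [DecidableEq V] {Y : Finset V} {f : V → V} (hf : ∀ v ∈ Y, f v ∉ Y) :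
    (starEdges Y f).card = Y.card := by
  refine Finset.card_image_of_injOn fun v hv w hw h => ?_
  rcases Sym2.eq_iff.1 h with h | h
  · exact h.1
  · exact absurd (h.1 ▸ hv) (hf w hw)

lemma isMatching_starEdges [DecidableEq V] {G : SimpleGraph V} {Y : Finset V} {f : V → V}
    (hG : ∀ v ∈ Y, G.Adj v (f v)) (hf : ∀ v ∈ Y, f v ∉ Y)
    (hi : ∀ v ∈ Y, ∀ w ∈ Y, f v = f w → v = w) : IsMatching G (starEdges Y f) := by
  refine ⟨?_, ?_⟩
  · intro e he
    obtain ⟨v, hv, rfl⟩ := mem_starEdges.1 he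
    exact hG v hv
  · intro e he e' he' hne x hx
    obtain ⟨v, hv, rfl⟩ := mem_starEdges.1 he
    obtain ⟨w, hw, rfl⟩ := mem_starEdges.1 he'
    simp only [Sym2.mem_iff] at hx
    have h1 := hf v hv
    have h2 := hf w hw
    have h3 := hi v hv w hw
    grind

/-- The counting behind `L ≤ 2l`: `F' \ F` is itself a matching outside `F`. The three facts are
stated separately because the case of equality needs each of them to be sharp. -/
lemma card_inter_le [DecidableEq V] {G : SimpleGraph V} {F F' H : Finset (Sym2 V)} {l : ℕ}
    (hF : IsMaximumMatching G F) (hF' : IsMaximumMatching G F')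
    (hHF' : ∀ e ∈ H, e ∉ F') (hl : ∀ M, IsMatching G M → (∀ e ∈ M, e ∉ F) → M.card ≤ l) :
    H ∩ F ⊆ F \ F' ∧ (F \ F').card = (F' \ F).card ∧ (F' \ F).card ≤ l := by
  refine ⟨fun e he => ?_, ?_, ?_⟩
  · simp only [Finset.mem_inter, Finset.mem_sdiff] at he ⊢
    exact ⟨he.2, hHF' e he.1⟩
  · exact Finset.card_sdiff_comm (hF.2.trans hF'.2.symm)
  · exact hl _ (hF'.1.subset Finset.sdiff_subset) fun e he => (Finset.mem_sdiff.1 he).2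

variable [Fintype V]

lemma bddAbove_matchings (G : SimpleGraph V) :
    BddAbove {k : ℕ | ∃ M : Finset (Sym2 V), IsMatching G M ∧ M.card = k} := by
  classical
  exact ⟨Fintype.card (Sym2 V), by rintro k ⟨M, -, rfl⟩; exact Finset.card_le_univ M⟩

lemma IsMatching.card_le {G : SimpleGraph V} {M : Finset (Sym2 V)} (h : IsMatching G M) :
    M.card ≤ matchingNumber G := le_csSup (bddAbove_matchings G) ⟨M, h, rfl⟩

lemma exists_isMaximumMatching (G : SimpleGraph V) : ∃ M, IsMaximumMatching G M :=
  Nat.sSup_mem (s := {k : ℕ | ∃ M : Finset (Sym2 V), IsMatching G M ∧ M.card = k})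
    ⟨0, ∅, isMatching_empty G, rfl⟩ (bddAbove_matchings G)

lemma matchingNumber_le {G : SimpleGraph V} {k : ℕ} (h : ∀ M, IsMatching G M → M.card ≤ k) :
    matchingNumber G ≤ k := by
  obtain ⟨M, hM, hc⟩ := exists_isMaximumMatching G
  exact hc ▸ h M hM

lemma residual_nonempty (G : SimpleGraph V) : (residualMatchingNumbers G).Nonempty := by
  obtain ⟨M, hM⟩ := exists_isMaximumMatching G
  exact ⟨_, M, hM, rfl⟩

lemma bddAbove_residual (G : SimpleGraph V) : BddAbove (residualMatchingNumbers G) := by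
  classical
  refine ⟨Fintype.card (Sym2 V), ?_⟩
  rintro k ⟨F, -, rfl⟩
  exact matchingNumber_le fun M _ => Finset.card_le_univ M

lemma exists_bigL (G : SimpleGraph V) : ∃ F H : Finset (Sym2 V), IsMaximumMatching G F ∧
    IsMatching G H ∧ (∀ e ∈ H, e ∉ F) ∧ H.card = bigL G := by
  obtain ⟨F, hF, hc⟩ := Nat.sSup_mem (residual_nonempty G) (bddAbove_residual G)
  obtain ⟨H, hH, hHc⟩ := exists_isMaximumMatching (G.deleteEdges (F : Set (Sym2 V)))
  rw [isMatching_deleteEdges] at hH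
  exact ⟨F, H, hF, hH.1, hH.2, hHc.trans hc⟩

lemma exists_smallL (G : SimpleGraph V) : ∃ F : Finset (Sym2 V), IsMaximumMatching G F ∧
    ∀ M, IsMatching G M → (∀ e ∈ M, e ∉ F) → M.card ≤ smallL G := by
  obtain ⟨F, hF, hc⟩ := Nat.sInf_mem (residual_nonempty G)
  refine ⟨F, hF, fun M hM hMF => ?_⟩
  have := (isMatching_deleteEdges.2 ⟨hM, hMF⟩).card_le
  rwa [hc] at this

lemma le_bigL {G : SimpleGraph V} {F H : Finset (Sym2 V)} (hF : IsMaximumMatching G F)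
    (hH : IsMatching G H) (hd : ∀ e ∈ H, e ∉ F) : H.card ≤ bigL G :=
  ((isMatching_deleteEdges.2 ⟨hH, hd⟩).card_le).trans
    (le_csSup (bddAbove_residual G) ⟨F, hF, rfl⟩)

lemma smallL_le {G : SimpleGraph V} {F : Finset (Sym2 V)} {k : ℕ} (hF : IsMaximumMatching G F)
    (h : ∀ M, IsMatching G M → (∀ e ∈ M, e ∉ F) → M.card ≤ k) : smallL G ≤ k :=
  (Nat.sInf_le (s := residualMatchingNumbers G) ⟨F, hF, rfl⟩).trans
    (matchingNumber_le fun M hM => h M (isMatching_deleteEdges.1 hM).1 (isMatching_deleteEdges.1 hM).2)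

/-! ### Maximum matchings have no short augmenting paths -/

/-- If `a` were missed as well, the edge `va` could be added to `F`. -/
lemma IsMaximumMatching.exists_partner [DecidableEq V] {G : SimpleGraph V} {F : Finset (Sym2 V)}
    (hF : IsMaximumMatching G F) {v a : V} (hv : ∀ e ∈ F, v ∉ e) (h : G.Adj v a) :
    ∃ b, s(a, b) ∈ F := by
  by_contra! hc
  have hva : s(v, a) ∉ F := fun h => hv _ h (by simp)
  have := (hF.1.insert (e := s(v, a)) h (by
    intro f hf x hx hxf
    rcases Sym2.mem_iff.1 hx with rfl | rfl
    · exact hv f hf hxf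
    · obtain ⟨y, rfl⟩ := hxf
      exact hc y hf)).card_le
  rw [Finset.card_insert_of_notMem hva, hF.2] at this
  omega

/-- Otherwise `v a b w` is an augmenting path: replacing `ab` by `va` and `wb` enlarges `F`. -/
lemma IsMaximumMatching.eq_of_adj_adj [DecidableEq V] {G : SimpleGraph V} {F : Finset (Sym2 V)}
    (hF : IsMaximumMatching G F) {v w a b : V} (hv : ∀ e ∈ F, v ∉ e) (hw : ∀ e ∈ F, w ∉ e)
    (hab : s(a, b) ∈ F) (hva : G.Adj v a) (hwb : G.Adj w b) : v = w := by
  by_contra hne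
  have hd : G.Adj a b := hF.1.1 _ hab
  have hvab := hv _ hab
  have hwab := hw _ hab
  simp only [Sym2.mem_iff, not_or] at hvab hwab
  have h1 : IsMatching G (F.erase s(a, b)) := hF.1.subset (Finset.erase_subset _ _)
  have hdis : ∀ f ∈ F.erase s(a, b), a ∉ f ∧ b ∉ f := by
    intro f hf
    rw [Finset.mem_erase] at hf
    exact ⟨fun h => hf.1 (hF.1.eq_of_mem hf.2 hab h (by simp)),
      fun h => hf.1 (hF.1.eq_of_mem hf.2 hab h (by simp))⟩
  have h2 := h1.insert (e := s(v, a)) hva (by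
    intro f hf x hx
    rcases Sym2.mem_iff.1 hx with rfl | rfl
    · exact hv f (Finset.mem_of_mem_erase hf)
    · exact (hdis f hf).1)
  have h3 := h2.insert (e := s(w, b)) hwb (by
    intro f hf x hx
    rcases Finset.mem_insert.1 hf with rfl | hf
    · rcases Sym2.mem_iff.1 hx with rfl | rfl
      · simp only [Sym2.mem_iff, not_or]
        exact ⟨Ne.symm hne, hwab.1⟩
      · simp only [Sym2.mem_iff, not_or]
        exact ⟨Ne.symm hvab.2, hd.ne'⟩
    · rcases Sym2.mem_iff.1 hx with rfl | rfl
      · exact hw f (Finset.mem_of_mem_erase hf)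
      · exact (hdis f hf).2)
  have h4 : s(v, a) ∉ F.erase s(a, b) := fun h =>
    hv _ (Finset.mem_of_mem_erase h) (by simp)
  have h5 : s(w, b) ∉ insert s(v, a) (F.erase s(a, b)) := fun h => by
    rcases Finset.mem_insert.1 h with h | h
    · rcases Sym2.eq_iff.1 h with h | h
      · exact hne h.1.symm
      · exact hwab.1 h.1
    · exact hw _ (Finset.mem_of_mem_erase h) (by simp)
  have := h3.card_le
  rw [Finset.card_insert_of_notMem h5, Finset.card_insert_of_notMem h4,
    Finset.card_erase_of_mem hab, ← hF.2] at this
  have := Finset.card_pos.2 ⟨_, hab⟩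
  omega

/-! ### The inequality `L ≤ 2 l` and the structure of the graphs with equality -/

section Extremal

variable [DecidableEq V] {G : SimpleGraph V} {F F' H : Finset (Sym2 V)} {l : ℕ}

lemma bigL_le_two_mul_smallL (G : SimpleGraph V) : bigL G ≤ 2 * smallL G := by
  obtain ⟨F', H, hF', hH, hHF', hc⟩ := exists_bigL G
  obtain ⟨F, hF, hl⟩ := exists_smallL G
  obtain ⟨h1, h2, h3⟩ := card_inter_le hF hF' hHF' hl
  have h4 := Finset.card_le_card h1
  have h5 := hl (H \ F) (hH.subset Finset.sdiff_subset) fun e he => (Finset.mem_sdiff.1 he).2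
  have h6 := Finset.card_inter_add_card_sdiff H F
  omega

/-- `F` is a maximum matching that misses the vertices of `Y`, the matching number of `G \ F` is at
most `|Y|`, and each `v` in `Y` has two neighbours `s v b` such that the edges of `F` at all these
neighbours are distinct. -/
structure Extremal (G : SimpleGraph V) (F : Finset (Sym2 V)) (Y : Finset V) (s : V → Bool → V) :
    Prop where
  max : IsMaximumMatching G F
  card_le : ∀ M, IsMatching G M → (∀ e ∈ M, e ∉ F) → M.card ≤ Y.card
  missed : ∀ v ∈ Y, ∀ e ∈ F, v ∉ e
  adj : ∀ v ∈ Y, ∀ b, G.Adj v (s v b)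
  distinct : ∀ v ∈ Y, ∀ w ∈ Y, ∀ b c, ∀ e ∈ F, s v b ∈ e → s w c ∈ e → v = w ∧ b = c

/-- Equality forces `F \ F' ⊆ H` and `|F' \ F| = |H \ F| = l`. An edge of `H \ F` meets some edge of
`F' \ F`, and an edge of `F' \ F` meets some edge of `F \ F'`; the edges of `H \ F` and of `F \ F'`
are disjoint, all being in `H`. So each edge of `F' \ F` has the form `vu` with `u` on an edge of `F
\ F'` and `v` on an edge `vw` of `H \ F`. The set `Y` collects these `v`, with neighbours `u` and
`w`. -/
lemma exists_extremal (hF : IsMaximumMatching G F) (hF' : IsMaximumMatching G F')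
    (hH : IsMatching G H) (hHF' : ∀ e ∈ H, e ∉ F')
    (hl : ∀ M, IsMatching G M → (∀ e ∈ M, e ∉ F) → M.card ≤ l) (hc : H.card = 2 * l) :
    ∃ Y s, Extremal G F Y s := by
  classical
  obtain ⟨h1, h2, h3⟩ := card_inter_le hF hF' hHF' hl
  have h4 := Finset.card_le_card h1
  have h5 := hl (H \ F) (hH.subset Finset.sdiff_subset) fun e he => (Finset.mem_sdiff.1 he).2
  have h6 := Finset.card_inter_add_card_sdiff H F
  have hA : H ∩ F = F \ F' := Finset.eq_of_subset_of_card_le h1 (by omega)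
  have hAH : ∀ e ∈ F, e ∉ F' → e ∈ H := fun e he he' => by
    have : e ∈ H ∩ F := hA ▸ Finset.mem_sdiff.2 ⟨he, he'⟩
    exact (Finset.mem_inter.1 this).1
  have hBcard : (F' \ F).card = l := by omega
  have hCcard : (H \ F).card = l := by omega
  -- every edge of `F' \ F` meets an edge of `F \ F'`
  have hBA : ∀ b ∈ F', b ∉ F → ∃ u ∈ b, ∃ a ∈ F, a ∉ F' ∧ u ∈ a := by
    intro b hb hbF
    by_contra! hcon
    have := (hF.1.insert (hF'.1.1 b hb) (by
      intro f hf v hv hvf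
      by_cases hfF : f ∈ F'
      · exact hbF (hF'.1.eq_of_mem hb hfF hv hvf ▸ hf)
      · exact hcon v hv f hf hfF hvf)).card_le
    rw [Finset.card_insert_of_notMem hbF, hF.2] at this
    omega
  -- every edge of `H \ F` meets an edge of `F' \ F`
  have hCB : ∀ c ∈ H \ F, ∃ b ∈ F' \ F, ∃ v, v ∈ c ∧ v ∈ b := by
    intro c hcC
    rw [Finset.mem_sdiff] at hcC
    by_contra! hcon
    have hcB : c ∉ F' \ F := fun h => hHF' c hcC.1 (Finset.mem_sdiff.1 h).1
    have := hl _ ((hF'.1.subset (Finset.sdiff_subset (t := F))).insert (hH.1 c hcC.1)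
      (fun f hf v hv hvf => hcon f hf v hv hvf)) (by
        intro e he
        rcases Finset.mem_insert.1 he with rfl | he
        · exact hcC.2
        · exact (Finset.mem_sdiff.1 he).2)
    rw [Finset.card_insert_of_notMem hcB] at this
    omega
  have hAC : ∀ a ∈ F, a ∉ F' → ∀ c ∈ H, c ∉ F → ∀ v, v ∈ a → v ∉ c :=
    fun a ha ha' c hc hcF v hva hvc => hcF (hH.eq_of_mem (hAH a ha ha') hc hva hvc ▸ ha)
  choose! φ hφB hφ using hCB
  -- One end of the edge `φ c` lies on an edge of `F \ F'`, hence on no edge of `H \ F`. So `c` and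
  -- `c'` both contain the other end.
  have hinj : Set.InjOn φ (H \ F : Finset (Sym2 V)) := by
    intro c hcC c' hcC' he
    obtain ⟨v, hvc, hvb⟩ := hφ c hcC
    obtain ⟨v', hvc', hvb'⟩ := hφ c' hcC'
    have hb := Finset.mem_sdiff.1 (hφB c hcC)
    have hcC := Finset.mem_sdiff.1 hcC
    have hcC' := Finset.mem_sdiff.1 hcC'
    obtain ⟨u, hub, a, ha, ha', hua⟩ := hBA _ hb.1 hb.2
    have n1 : u ≠ v := fun h => hAC a ha ha' c hcC.1 hcC.2 u hua (h ▸ hvc)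
    have n2 : u ≠ v' := fun h => hAC a ha ha' c' hcC'.1 hcC'.2 u hua (h ▸ hvc')
    rw [← he] at hvb'
    have e1 := (Sym2.mem_and_mem_iff n1).1 ⟨hub, hvb⟩
    rw [e1, Sym2.mem_iff] at hvb'
    have : v' = v := by tauto
    subst this
    exact hH.eq_of_mem hcC.1 hcC'.1 hvc hvc'
  have hsurj : (H \ F).image φ = F' \ F := by
    refine Finset.eq_of_subset_of_card_le (Finset.image_subset_iff.2 hφB) ?_
    rw [Finset.card_image_of_injOn hinj]
    omega
  let R : V → V → V → Prop := fun v u w =>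
    s(v, u) ∈ F' \ F ∧ s(v, w) ∈ H \ F ∧ ∃ a ∈ F, a ∉ F' ∧ u ∈ a
  have hR : ∀ b ∈ F' \ F, ∃ v, v ∈ b ∧ ∃ u w, R v u w := by
    intro b hb
    have hb' := hb
    rw [← hsurj, Finset.mem_image] at hb'
    obtain ⟨c, hc, rfl⟩ := hb'
    obtain ⟨v, hvc, hvb⟩ := hφ c hc
    have hbB := Finset.mem_sdiff.1 hb
    have hcC := Finset.mem_sdiff.1 hc
    obtain ⟨u, hub, a, ha, ha', hua⟩ := hBA _ hbB.1 hbB.2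
    have n1 : v ≠ u := fun h => hAC a ha ha' c hcC.1 hcC.2 u hua (h ▸ hvc)
    have e1 := (Sym2.mem_and_mem_iff n1).1 ⟨hvb, hub⟩
    obtain ⟨w, hw⟩ := hvc
    exact ⟨v, hvb, u, w, e1 ▸ hb, hw ▸ hc, a, ha, ha', hua⟩
  have hRmissed : ∀ v u w, R v u w → ∀ e ∈ F, v ∉ e := by
    rintro v u w ⟨hb, hc, -⟩ e he hve
    rw [Finset.mem_sdiff] at hb hc
    by_cases heF : e ∈ F'
    · exact hb.2 (hF'.1.eq_of_mem heF hb.1 hve (by simp) ▸ he)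
    · exact hAC e he heF _ hc.1 hc.2 v hve (by simp)
  let Y : Finset V := Finset.univ.filter fun v => ∃ u w, R v u w
  have hY : ∀ v ∈ Y, ∃ u w, R v u w := fun v hv => (Finset.mem_filter.1 hv).2
  choose! u w huw using hY
  have hYF : ∀ v ∈ Y, ∀ e ∈ F, v ∉ e := fun v hv => hRmissed _ _ _ (huw v hv)
  have hu : ∀ v ∈ Y, G.Adj v (u v) := fun v hv =>
    hF'.1.1 _ (Finset.mem_sdiff.1 (huw v hv).1).1
  have hw : ∀ v ∈ Y, G.Adj v (w v) := fun v hv =>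
    hH.1 _ (Finset.mem_sdiff.1 (huw v hv).2.1).1
  have huu : ∀ v ∈ Y, ∀ v' ∈ Y, ∀ e ∈ F, u v ∈ e → u v' ∈ e → v = v' := by
    intro v hv v' hv' e he h h'
    by_cases huv : u v = u v'
    · have q := (Finset.mem_sdiff.1 (huw v hv).1).1
      have q' := (Finset.mem_sdiff.1 (huw v' hv').1).1
      rw [Sym2.eq_swap] at q q'
      rw [← huv] at q'
      exact hF'.1.right_unique q q'
    · have := (Sym2.mem_and_mem_iff huv).1 ⟨h, h'⟩
      exact hF.eq_of_adj_adj (hYF v hv) (hYF v' hv') (this ▸ he) (hu v hv) (hu v' hv')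
  have hww : ∀ v ∈ Y, ∀ v' ∈ Y, ∀ e ∈ F, w v ∈ e → w v' ∈ e → v = v' := by
    intro v hv v' hv' e he h h'
    by_cases hwv : w v = w v'
    · have q := (Finset.mem_sdiff.1 (huw v hv).2.1).1
      have q' := (Finset.mem_sdiff.1 (huw v' hv').2.1).1
      rw [Sym2.eq_swap] at q q'
      rw [← hwv] at q'
      exact hH.right_unique q q'
    · have := (Sym2.mem_and_mem_iff hwv).1 ⟨h, h'⟩
      exact hF.eq_of_adj_adj (hYF v hv) (hYF v' hv') (this ▸ he) (hw v hv) (hw v' hv')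
  -- The edge of `F` at `u v` belongs to `F \ F'`, hence to `H`, and cannot share `w v'` with
  -- another edge of `H`.
  have huw' : ∀ v ∈ Y, ∀ v' ∈ Y, ∀ e ∈ F, u v ∈ e → w v' ∉ e := by
    intro v hv v' hv' e he h h'
    obtain ⟨-, -, a, ha, ha', hua⟩ := huw v hv
    obtain rfl := hF.1.eq_of_mem ha he hua h
    have := Finset.mem_sdiff.1 (huw v' hv').2.1
    exact hAC a ha ha' _ this.1 this.2 _ h' (by simp)
  refine ⟨Y, fun v b => if b then u v else w v, hF, ?_, hYF, ?_, ?_⟩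
  · intro M hM hMF
    refine (hl M hM hMF).trans ?_
    rw [← hBcard]
    refine (Finset.card_le_card fun b hb => ?_).trans
      (Finset.card_image_le (s := Y) (f := fun v => s(v, u v)))
    obtain ⟨v, hvb, hv⟩ := hR b hb
    have hvY : v ∈ Y := Finset.mem_filter.2 ⟨Finset.mem_univ _, hv⟩
    exact Finset.mem_image.2 ⟨v, hvY, hF'.1.eq_of_mem (Finset.mem_sdiff.1 (huw v hvY).1).1
      (Finset.mem_sdiff.1 hb).1 (by simp) hvb⟩
  · intro v hv b
    cases b
    · simpa using hw v hv
    · simpa using hu v hv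
  · intro v hv v' hv' b b' e he h h'
    cases b <;> cases b' <;> simp only [if_true, Bool.false_eq_true, if_false] at h h'
    · exact ⟨hww v hv v' hv' e he h h', rfl⟩
    · exact absurd h (huw' v' hv' v hv e he h')
    · exact absurd h' (huw' v hv v' hv' e he h)
    · exact ⟨huu v hv v' hv' e he h h', rfl⟩

end Extremal

end MatchingPairs

namespace MatchingPairs

/-! ### A local description of the extremal matching -/

section Tight

variable {V : Type*} (G : SimpleGraph V)

/-- An edge `ab` such that `a` or `b` has degree one, or `a` and `b` have degree two and a common
neighbour. -/
def Tight (a b : V) : Prop :=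
  G.Adj a b ∧ ((∀ x, G.Adj a x → x = b) ∨ (∀ x, G.Adj b x → x = a) ∨
    ∃ c, G.Adj a c ∧ G.Adj b c ∧ (∀ x, G.Adj a x → x = b ∨ x = c) ∧
      ∀ x, G.Adj b x → x = a ∨ x = c)

/-- The vertex `a` lies on a tight edge. -/
def Covered (a : V) : Prop := ∃ b, Tight G a b

/-- The vertex `v` has a neighbour, but lies on no tight edge. -/
def Free (v : V) : Prop := (∃ x, G.Adj v x) ∧ ¬ Covered G v

/-- The local part of the characterization of the graphs with `L = 2 l`. -/
def LocallyGood : Prop :=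
  (∀ a b c, Tight G a b → Tight G a c → b = c) ∧
  (∀ a b, G.Adj a b → Covered G a ∨ Covered G b) ∧
  ∀ a b, G.Adj a b → ¬ Tight G a b → Covered G a → Covered G b →
    ∃ v, Free G v ∧ G.Adj v a ∧ G.Adj v b ∧ ∀ x, G.Adj v x → x = a ∨ x = b

/-- Each free vertex `v` can be given two neighbours `s v b` such that the tight edges at all these
neighbours are distinct. -/
def HasSystem : Prop :=
  ∃ s : V → Bool → V, (∀ v b, Free G v → G.Adj v (s v b)) ∧
    ∀ v b w c, Free G v → Free G w → (s v b = s w c ∨ Tight G (s v b) (s w c)) → v = w ∧ b = c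

variable {G}

lemma Tight.symm {a b : V} (h : Tight G a b) : Tight G b a := by
  obtain ⟨h, h1 | h1 | ⟨c, h1, h2, h3, h4⟩⟩ := h
  · exact ⟨h.symm, Or.inr (Or.inl h1)⟩
  · exact ⟨h.symm, Or.inl h1⟩
  · exact ⟨h.symm, Or.inr (Or.inr ⟨c, h2, h1, h4, h3⟩)⟩

/-- Two edges that meet the same tight edge meet each other. -/
lemma Tight.exists_common {a b : V} (h : Tight G a b) {e f : Sym2 V} (he : e ∈ G.edgeSet)
    (hf : f ∈ G.edgeSet) (hae : a ∈ e ∨ b ∈ e) (haf : a ∈ f ∨ b ∈ f) : ∃ v, v ∈ e ∧ v ∈ f := by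
  induction e with | _ p q
  induction f with | _ r t
  simp only [SimpleGraph.mem_edgeSet, Sym2.mem_iff] at *
  have e1 := he.symm
  have f1 := hf.symm
  obtain ⟨h, h1 | h1 | ⟨c, h1, h2, h3, h4⟩⟩ := h
  · have : b = p ∨ b = q := by grind
    have : b = r ∨ b = t := by grind
    exact ⟨b, by assumption, by assumption⟩
  · have : a = p ∨ a = q := by grind
    have : a = r ∨ a = t := by grind
    exact ⟨a, by assumption, by assumption⟩
  · by_contra! hcon
    have := hcon p
    have := hcon q
    grind

end Tight

variable {V : Type*} [Fintype V] [DecidableEq V] {G : SimpleGraph V}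

/-! ### Locally good graphs with a system satisfy `L = 2l` -/

section Sufficiency

open Classical in
/-- The set of tight edges. -/
noncomputable def tightEdges (G : SimpleGraph V) : Finset (Sym2 V) :=
  Finset.univ.filter fun e => ∃ a b, e = s(a, b) ∧ Tight G a b

open Classical in
/-- The set of free vertices. -/
noncomputable def freeVerts (G : SimpleGraph V) : Finset V := Finset.univ.filter fun v => Free G v

lemma mem_tightEdges {a b : V} : s(a, b) ∈ tightEdges G ↔ Tight G a b := by
  simp only [tightEdges, Finset.mem_filter, Finset.mem_univ, true_and]
  refine ⟨?_, fun h => ⟨a, b, rfl, h⟩⟩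
  rintro ⟨c, d, h, ht⟩
  rcases Sym2.eq_iff.1 h with ⟨rfl, rfl⟩ | ⟨rfl, rfl⟩
  · exact ht
  · exact ht.symm

lemma mem_freeVerts {v : V} : v ∈ freeVerts G ↔ Free G v := by simp [freeVerts]

lemma LocallyGood.isMatching (h : LocallyGood G) : IsMatching G (tightEdges G) := by
  refine ⟨?_, ?_⟩
  · intro e he
    induction e with | _ a b
    exact (mem_tightEdges.1 he).1
  · rintro e he f hf hne v ⟨⟨x, rfl⟩, ⟨y, rfl⟩⟩
    exact hne (by rw [h.1 v x y (mem_tightEdges.1 he) (mem_tightEdges.1 hf)])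

/-- Send each edge of `M` to a tight edge that it meets. Edges meeting the same tight edge meet each
other, so this is injective on a matching. -/
lemma LocallyGood.card_le_tight (h : LocallyGood G) {M : Finset (Sym2 V)} (hM : IsMatching G M) :
    M.card ≤ (tightEdges G).card := by
  have key : ∀ e ∈ M, ∃ f ∈ tightEdges G, ∃ v, v ∈ e ∧ v ∈ f := by
    intro e he
    induction e with | _ a b
    rcases h.2.1 a b (hM.1 _ he) with ⟨c, hc⟩ | ⟨c, hc⟩
    · exact ⟨_, mem_tightEdges.2 hc, a, by simp, by simp⟩
    · exact ⟨_, mem_tightEdges.2 hc, b, by simp, by simp⟩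
  choose! φ hφ hφ' using key
  refine Finset.card_le_card_of_injOn φ hφ ?_
  intro e he f hf hef
  obtain ⟨v, hv, hv'⟩ := hφ' e he
  obtain ⟨w, hw, hw'⟩ := hφ' f hf
  have ht := hφ e he
  rw [← hef] at hw'
  revert hv' hw' ht
  generalize φ e = t
  induction t with | _ a b
  intro hv' hw' ht
  obtain ⟨x, hx, hx'⟩ := (mem_tightEdges.1 ht).exists_common (hM.1 e he) (hM.1 f hf)
    (by rcases Sym2.mem_iff.1 hv' with rfl | rfl <;> simp [hv])
    (by rcases Sym2.mem_iff.1 hw' with rfl | rfl <;> simp [hw])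
  exact hM.eq_of_mem he hf hx hx'

lemma LocallyGood.isMaximumMatching (h : LocallyGood G) : IsMaximumMatching G (tightEdges G) :=
  ⟨h.isMatching, le_antisymm h.isMatching.card_le (matchingNumber_le fun _ hM => h.card_le_tight hM)⟩

/-- Send each edge of `M` to a free end or, if both ends are covered, to a free vertex all of whose
neighbours are these ends. Two edges sent to the same `v` intersect in `v` or in a neighbour of `v`.
-/
lemma LocallyGood.card_le_free (h : LocallyGood G) {M : Finset (Sym2 V)} (hM : IsMatching G M)
    (hMF : ∀ e ∈ M, e ∉ tightEdges G) : M.card ≤ (freeVerts G).card := by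
  have key : ∀ e : M, ∃ v, Free G v ∧ (v ∈ e.1 ∨ ∀ x, G.Adj v x → x ∈ e.1) := by
    rintro ⟨e, he⟩
    induction e with | _ a b
    have hab : G.Adj a b := hM.1 _ he
    by_cases ha : Covered G a
    · by_cases hb : Covered G b
      · obtain ⟨v, hv, -, -, hx⟩ := h.2.2 a b hab (fun ht => hMF _ he (mem_tightEdges.2 ht)) ha hb
        exact ⟨v, hv, Or.inr fun x h => by simpa using hx x h⟩
      · exact ⟨b, ⟨⟨a, hab.symm⟩, hb⟩, by simp⟩
    · exact ⟨a, ⟨⟨b, hab⟩, ha⟩, by simp⟩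
  choose φ hφ hφ' using key
  rw [← Fintype.card_coe M]
  refine Finset.card_le_card_of_injOn φ (s := Finset.univ)
    (fun e _ => by simpa using mem_freeVerts.2 (hφ e)) ?_
  intro e _ f _ hef
  have he := hφ' e
  have hf := hφ' f
  rw [← hef] at hf
  have nbr : ∀ e : M, ∀ v, v ∈ e.1 → ∃ x, G.Adj v x ∧ x ∈ e.1 := by
    rintro ⟨e, he⟩ v ⟨x, rfl⟩
    exact ⟨x, hM.1 _ he, by simp⟩
  have : ∃ x, x ∈ e.1 ∧ x ∈ f.1 := by
    rcases he with he | he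
    · rcases hf with hf | hf
      · exact ⟨_, he, hf⟩
      · obtain ⟨x, hx, hx'⟩ := nbr e _ he
        exact ⟨x, hx', hf x hx⟩
    · rcases hf with hf | hf
      · obtain ⟨x, hx, hx'⟩ := nbr f _ hf
        exact ⟨x, he x hx, hx'⟩
      · obtain ⟨x, hx⟩ := (hφ e).1
        exact ⟨x, he x hx, hf x hx⟩
  obtain ⟨x, hx, hx'⟩ := this
  exact Subtype.ext (hM.eq_of_mem e.2 f.2 hx hx')

/-- In the matching of tight edges, replace those at the first chosen neighbours by the edges from
the free vertices to these neighbours. The removed edges together with the edges to the second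
chosen neighbours form a matching that avoids the new maximum matching. -/
lemma LocallyGood.two_mul_card_free_le (h : LocallyGood G) (hs : HasSystem G) :
    2 * (freeVerts G).card ≤ bigL G := by
  obtain ⟨s, hadj, hdis⟩ := hs
  set Y := freeVerts G with hY
  have hfree : ∀ v ∈ Y, Free G v := fun v hv => mem_freeVerts.1 hv
  have hcov : ∀ v ∈ Y, ∀ b, Covered G (s v b) := fun v hv b =>
    (h.2.1 _ _ (hadj v b (hfree v hv))).resolve_left (hfree v hv).2
  have hnot : ∀ v ∈ Y, ∀ b, s v b ∉ Y := fun v hv b hb => (hfree _ hb).2 (hcov v hv b)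
  have hp : ∀ v, ∃ p, v ∈ Y → Tight G (s v true) p := fun v => by
    by_cases hv : v ∈ Y
    · obtain ⟨p, hp⟩ := hcov v hv true
      exact ⟨p, fun _ => hp⟩
    · exact ⟨v, fun h => absurd h hv⟩
  choose p hp using hp
  have hpcov : ∀ v ∈ Y, Covered G (p v) := fun v hv => ⟨_, (hp v hv).symm⟩
  -- the tight edges at the first chosen neighbours
  let A : Finset (Sym2 V) := Y.image fun v => s(s v true, p v)
  have hA : A ⊆ tightEdges G := by
    intro e he
    obtain ⟨v, hv, rfl⟩ := Finset.mem_image.1 he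
    exact mem_tightEdges.2 (hp v hv)
  have hmemA : ∀ v ∈ Y, ∀ e ∈ tightEdges G, s v true ∈ e → e ∈ A := by
    rintro v hv e he ⟨x, rfl⟩
    rw [h.1 _ _ _ (mem_tightEdges.1 he) (hp v hv)]
    exact Finset.mem_image_of_mem _ hv
  have hAcard : A.card = Y.card := by
    refine Finset.card_image_of_injOn fun v hv w hw e => ?_
    rcases Sym2.eq_iff.1 e with ⟨e, -⟩ | ⟨-, e⟩
    · exact (hdis v true w true (hfree v hv) (hfree w hw) (Or.inl e)).1
    · exact (hdis v true w true (hfree v hv) (hfree w hw) (Or.inr (e ▸ hp v hv))).1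
  have hB : ∀ b, IsMatching G (starEdges Y fun v => s v b) := fun b =>
    isMatching_starEdges (fun v hv => hadj v b (hfree v hv)) (fun v hv => hnot v hv b)
      fun v hv w hw e => (hdis v b w b (hfree v hv) (hfree w hw) (Or.inl e)).1
  have hBcard : ∀ b, (starEdges Y fun v => s v b).card = Y.card := fun b =>
    card_starEdges fun v hv => hnot v hv b
  have hFY : ∀ v ∈ Y, ∀ e ∈ tightEdges G, v ∉ e := by
    rintro v hv e he ⟨x, rfl⟩
    exact (hfree v hv).2 ⟨x, mem_tightEdges.1 he⟩
  have hF' : IsMatching G ((tightEdges G \ A) ∪ starEdges Y fun v => s v true) := by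
    refine (h.isMatching.subset Finset.sdiff_subset).union (hB true) ?_
    intro e he f hf x hx hxf
    obtain ⟨he, heA⟩ := Finset.mem_sdiff.1 he
    obtain ⟨v, hv, rfl⟩ := mem_starEdges.1 hf
    rcases Sym2.mem_iff.1 hxf with rfl | rfl
    · exact hFY x hv e he hx
    · exact heA (hmemA v hv e he hx)
  have hdisj : Disjoint (tightEdges G \ A) (starEdges Y fun v => s v true) := by
    rw [Finset.disjoint_left]
    intro e he hf
    obtain ⟨v, hv, rfl⟩ := mem_starEdges.1 hf
    exact hFY v hv _ (Finset.mem_sdiff.1 he).1 (by simp)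
  have hF'max : IsMaximumMatching G ((tightEdges G \ A) ∪ starEdges Y fun v => s v true) := by
    refine ⟨hF', ?_⟩
    rw [← h.isMaximumMatching.2, Finset.card_union_of_disjoint hdisj, hBcard,
      Finset.card_sdiff_of_subset hA, hAcard]
    have := Finset.card_le_card hA
    omega
  have hH : IsMatching G (A ∪ starEdges Y fun v => s v false) := by
    refine (h.isMatching.subset hA).union (hB false) ?_
    intro e he f hf x hx hxf
    obtain ⟨w, hw, rfl⟩ := mem_starEdges.1 hf
    rcases Sym2.mem_iff.1 hxf with rfl | rfl
    · exact hFY x hw e (hA he) hx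
    · obtain ⟨v, hv, rfl⟩ := Finset.mem_image.1 he
      have : s w false = s v true ∨ Tight G (s w false) (s v true) := by
        rcases Sym2.mem_iff.1 hx with e | e
        · exact Or.inl e
        · exact Or.inr (e ▸ (hp v hv).symm)
      exact absurd (hdis w false v true (hfree w hw) (hfree v hv) this).2 (by simp)
  have hHdisj : Disjoint A (starEdges Y fun v => s v false) := by
    rw [Finset.disjoint_left]
    intro e he hf
    obtain ⟨v, hv, rfl⟩ := mem_starEdges.1 hf
    exact hFY v hv _ (hA he) (by simp)
  have := le_bigL hF'max hH (by
    intro e he he'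
    rcases Finset.mem_union.1 he with he | he <;> rcases Finset.mem_union.1 he' with he' | he'
    · exact (Finset.mem_sdiff.1 he').2 he
    · obtain ⟨v, hv, rfl⟩ := mem_starEdges.1 he'
      exact hFY v hv _ (hA he) (by simp)
    · obtain ⟨v, hv, rfl⟩ := mem_starEdges.1 he
      exact hFY v hv _ (Finset.mem_sdiff.1 he').1 (by simp)
    · obtain ⟨v, hv, rfl⟩ := mem_starEdges.1 he
      obtain ⟨w, hw, e⟩ := mem_starEdges.1 he'
      rcases Sym2.eq_iff.1 e with ⟨rfl, e⟩ | ⟨rfl, -⟩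
      · exact absurd (hdis _ true _ false (hfree _ hw) (hfree _ hv) (Or.inl e)).2 (by simp)
      · exact hnot v hv false hw)
  rwa [Finset.card_union_of_disjoint hHdisj, hAcard, hBcard, ← two_mul] at this

/-- With `y` free vertices, `2y ≤ L ≤ 2l ≤ 2y`. -/
lemma LocallyGood.bigL_eq (h : LocallyGood G) (hs : HasSystem G) : bigL G = 2 * smallL G := by
  have h1 := bigL_le_two_mul_smallL G
  have h2 := h.two_mul_card_free_le hs
  have h3 := smallL_le h.isMaximumMatching fun _ hM hMF => h.card_le_free hM hMF
  omega

end Sufficiency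

/-! ### The extremal structure determines the tight edges and the free vertices -/

section Necessity

variable {F : Finset (Sym2 V)} {Y : Finset V} {s : V → Bool → V}

lemma Extremal.exists_partner (h : Extremal G F Y s) {v : V} (hv : v ∈ Y) (b : Bool) :
    ∃ p, s(s v b, p) ∈ F := h.max.exists_partner (h.missed v hv) (h.adj v hv b)

lemma Extremal.injective (h : Extremal G F Y s) {v w : V} (hv : v ∈ Y) (hw : w ∈ Y) {b c : Bool}
    (e : s v b = s w c) : v = w ∧ b = c := by
  obtain ⟨p, hp⟩ := h.exists_partner hv b
  exact h.distinct v hv w hw b c _ hp (by simp) (by simp [e])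

lemma Extremal.notMem_of_mem (h : Extremal G F Y s) {a b : V} (hab : s(a, b) ∈ F) : a ∉ Y :=
  fun ha => h.missed a ha _ hab (by simp)

lemma Extremal.notMem_of_adj (h : Extremal G F Y s) {v a : V} (hv : v ∈ Y) (hva : G.Adj v a) :
    a ∉ Y := by
  obtain ⟨p, hp⟩ := h.max.exists_partner (h.missed v hv) hva
  exact h.notMem_of_mem hp

/-- Otherwise the edges `v (f v)` and `ab` would form a matching outside `F` with `|Y| + 1` edges.
The freedom in `f` is what the next lemmas exploit. -/
lemma Extremal.exists_eq_of_adj (h : Extremal G F Y s) {f : V → V} (hf : ∀ v ∈ Y, G.Adj v (f v))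
    (hi : ∀ v ∈ Y, ∀ w ∈ Y, f v = f w → v = w) {a b : V} (hab : G.Adj a b) (hF : s(a, b) ∉ F)
    (ha : a ∉ Y) (hb : b ∉ Y) : ∃ v ∈ Y, f v = a ∨ f v = b := by
  by_contra! hcon
  have hfY : ∀ v ∈ Y, f v ∉ Y := fun v hv => h.notMem_of_adj hv (hf v hv)
  have hnot : s(a, b) ∉ starEdges Y f := fun hm => by
    obtain ⟨v, hv, e⟩ := mem_starEdges.1 hm
    rcases Sym2.eq_iff.1 e with ⟨rfl, -⟩ | ⟨rfl, -⟩
    · exact ha hv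
    · exact hb hv
  have := h.card_le _ ((isMatching_starEdges hf hfY hi).insert (e := s(a, b)) hab (by
    intro e he x hx hxe
    obtain ⟨v, hv, rfl⟩ := mem_starEdges.1 he
    have := hcon v hv
    simp only [Sym2.mem_iff] at hx hxe
    grind)) (by
    intro e he
    rcases Finset.mem_insert.1 he with rfl | he
    · exact hF
    · obtain ⟨v, hv, rfl⟩ := mem_starEdges.1 he
      exact fun hm => h.missed v hv _ hm (by simp))
  rw [Finset.card_insert_of_notMem hnot, card_starEdges hfY] at this
  omega

lemma Extremal.exists_eq_pair (h : Extremal G F Y s) {a b : V} (hab : G.Adj a b)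
    (hF : s(a, b) ∉ F) (ha : a ∉ Y) (hb : b ∉ Y) :
    ∃ v ∈ Y, ∃ c, a = s v c ∧ b = s v (!c) := by
  have key : ∀ a b, G.Adj a b → s(a, b) ∉ F → a ∉ Y → b ∉ Y → ∀ v ∈ Y, a = s v true →
      b = s v false := by
    intro a b hab hF ha hb v hv hva
    -- In this choice `v` gives up `a`, so nobody takes `a`, and every other vertex avoids `b`. Only
    -- `v` can then hit the edge, by taking `b`.
    obtain ⟨w, hw, hw'⟩ := h.exists_eq_of_adj
      (f := fun x => s x (if x = v then false else if s x true = b then false else true))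
      (fun x hx => h.adj x hx _) (fun x hx y hy e => (h.injective hx hy e).1) hab hF ha hb
    rcases hw' with hw' | hw'
    · rw [hva] at hw'
      obtain ⟨rfl, hc⟩ := h.injective hw hv hw'
      simp at hc
    · by_cases hwv : w = v
      · subst hwv
        simpa using hw'.symm
      · simp only [hwv, if_false] at hw'
        split_ifs at hw' with h1
        · exact absurd (h.injective hw hw (hw'.trans h1.symm)).2 (by simp)
        · exact absurd hw' h1
  obtain ⟨v, hv, hv'⟩ := h.exists_eq_of_adj (f := fun x => s x true)
      (fun x hx => h.adj x hx _) (fun x hx y hy e => (h.injective hx hy e).1) hab hF ha hb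
  rcases hv' with hv' | hv'
  · exact ⟨v, hv, true, hv'.symm, key a b hab hF ha hb v hv hv'.symm⟩
  · exact ⟨v, hv, false, key b a hab.symm (by rwa [Sym2.eq_swap]) hb ha v hv hv'.symm, hv'.symm⟩

lemma Extremal.not_mem_pair (h : Extremal G F Y s) {v : V} (hv : v ∈ Y) (c : Bool) :
    s(s v c, s v (!c)) ∉ F := fun hm => by
  have := (h.distinct v hv v hv c (!c) _ hm (by simp) (by simp)).2
  cases c <;> simp at this

/-- Were `y` a third neighbour of `v`, then `v` could take `y` while the others choose neighbours
different from `y`. No chosen vertex would then lie on the edge joining the pair of `v`. -/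
lemma Extremal.eq_or_eq_of_adj (h : Extremal G F Y s) {v : V} (hv : v ∈ Y) {c : Bool}
    (hc : G.Adj (s v c) (s v (!c))) {y : V} (hy : G.Adj v y) : y = s v c ∨ y = s v (!c) := by
  by_contra! hcon
  let f : V → V := fun x => if x = v then y else s x (if s x true = y then false else true)
  have hfv : f v = y := by simp [f]
  have hf : ∀ x, x ≠ v → f x = s x (if s x true = y then false else true) := fun x hx => by
    simp [f, hx]
  have hfy : ∀ x ∈ Y, x ≠ v → f x ≠ y := fun x hx hxv e => by
    rw [hf x hxv] at e
    split_ifs at e with h1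
    · exact absurd (h.injective hx hx (e.trans h1.symm)).2 (by simp)
    · exact h1 e
  have hy' := h.notMem_of_adj hv hy
  obtain ⟨w, hw, hw'⟩ := h.exists_eq_of_adj (f := f)
    (fun x hx => by
      by_cases hxv : x = v
      · subst hxv; rwa [hfv]
      · rw [hf x hxv]; exact h.adj x hx _)
    (fun x hx z hz e => by
      by_cases hxv : x = v
      · by_cases hzv : z = v
        · rw [hxv, hzv]
        · rw [hxv, hfv] at e
          exact absurd e.symm (hfy z hz hzv)
      · by_cases hzv : z = v
        · rw [hzv, hfv] at e
          exact absurd e (hfy x hx hxv)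
        · rw [hf x hxv, hf z hzv] at e
          exact (h.injective hx hz e).1)
    hc (h.not_mem_pair hv c) (h.notMem_of_adj hv (h.adj v hv _)) (h.notMem_of_adj hv (h.adj v hv _))
  by_cases hwv : w = v
  · rw [hwv, hfv] at hw'
    tauto
  · rw [hf w hwv] at hw'
    rcases hw' with e | e <;> exact hwv (h.injective hw hv e).1

/-- A vertex on an edge of `F` with a further neighbour has a neighbour in `Y`. -/
lemma Extremal.exists_adj (h : Extremal G F Y s) {a b x : V} (hab : s(a, b) ∈ F)
    (hax : G.Adj a x) (hxb : x ≠ b) : ∃ v ∈ Y, G.Adj v a ∧ (x ∉ Y →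
      ∃ c, a = s v c ∧ x = s v (!c)) := by
  by_cases hx : x ∈ Y
  · exact ⟨x, hx, hax.symm, fun h => absurd hx h⟩
  · obtain ⟨v, hv, c, rfl, rfl⟩ := h.exists_eq_pair hax
      (fun hm => hxb (h.max.1.right_unique hm hab)) (h.notMem_of_mem hab) hx
    exact ⟨v, hv, h.adj v hv c, fun _ => ⟨c, rfl, rfl⟩⟩

/-- A further neighbour `x` of `a` yields a vertex of `Y` adjacent to `a`, which must be `v`. If `x`
is not in `Y`, then `a` and `x` are the pair of `v` and its only neighbours, so `b` is one of them;
but `b ≠ a`, and no pair is an edge of `F`. -/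
lemma Extremal.eq_of_adj (h : Extremal G F Y s) {a b v x : V} (hab : s(a, b) ∈ F) (hv : v ∈ Y)
    (hvb : G.Adj v b) (hax : G.Adj a x) : x = b ∨ x = v := by
  by_contra! hcon
  obtain ⟨w, hw, hwa, hwx⟩ := h.exists_adj hab hax hcon.1
  obtain rfl := h.max.eq_of_adj_adj (h.missed w hw) (h.missed v hv) hab hwa hvb
  by_cases hx : x ∈ Y
  · exact hcon.2 (h.max.eq_of_adj_adj (h.missed x hx) (h.missed w hw) hab hax.symm hvb)
  · obtain ⟨c, rfl, rfl⟩ := hwx hx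
    rcases h.eq_or_eq_of_adj hv hax hvb with rfl | rfl
    · exact (show G.Adj _ _ from h.max.1.1 _ hab).ne rfl
    · exact h.not_mem_pair hv c hab

/-- If both ends have a further neighbour, both have a neighbour in `Y`. These coincide, as there is
no augmenting path, and give the triangle in the definition of `Tight`. -/
lemma Extremal.tight_of_mem (h : Extremal G F Y s) {a b : V} (hab : s(a, b) ∈ F) : Tight G a b := by
  have hG : G.Adj a b := h.max.1.1 _ hab
  have hba : s(b, a) ∈ F := by rwa [Sym2.eq_swap]
  refine ⟨hG, ?_⟩
  by_cases ha : ∀ x, G.Adj a x → x = b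
  · exact Or.inl ha
  by_cases hb : ∀ x, G.Adj b x → x = a
  · exact Or.inr (Or.inl hb)
  push Not at ha hb
  obtain ⟨x, hax, hxb⟩ := ha
  obtain ⟨y, hby, hya⟩ := hb
  obtain ⟨v, hv, hva, -⟩ := h.exists_adj hab hax hxb
  obtain ⟨w, hw, hwb, -⟩ := h.exists_adj hba hby hya
  obtain rfl := h.max.eq_of_adj_adj (h.missed v hv) (h.missed w hw) hab hva hwb
  exact Or.inr (Or.inr ⟨v, hva.symm, hwb.symm, fun x hx => h.eq_of_adj hab hv hwb hx,
    fun x hx => h.eq_of_adj hba hv hva hx⟩)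

/-- The vertex `v` has two neighbours, and `b` has its partner `p` in `F` besides `v`. In the
triangle case both chosen neighbours of `v` would be ends of the same edge `bp` of `F`. -/
lemma Extremal.not_tight_of_mem_left (h : Extremal G F Y s) {v b : V} (hv : v ∈ Y) :
    ¬ Tight G v b := by
  rintro ⟨hvb, ht⟩
  obtain ⟨p, hp⟩ := h.max.exists_partner (h.missed v hv) hvb
  have hpv : p ≠ v := by
    rintro rfl
    exact h.missed p hv _ hp (by simp)
  have hbp : G.Adj b p := h.max.1.1 _ hp
  rcases ht with ht | ht | ⟨c, h1, h2, h3, h4⟩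
  · have := (ht _ (h.adj v hv true)).trans (ht _ (h.adj v hv false)).symm
    exact absurd (h.injective hv hv this).2 (by simp)
  · exact hpv (ht p hbp)
  · obtain rfl := (h4 p hbp).resolve_left hpv
    have ht := h3 _ (h.adj v hv true)
    have hf := h3 _ (h.adj v hv false)
    exact absurd (h.distinct v hv v hv true false _ hp (by simpa using ht) (by simpa using hf)).2
      (by simp)

/-- Each vertex of the pair is adjacent to `v` and to its partner in `F`, which is neither `v` nor
the other vertex; if the two are adjacent, their degrees are at least three. -/
lemma Extremal.not_tight_pair (h : Extremal G F Y s) {v : V} (hv : v ∈ Y) (c : Bool) :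
    ¬ Tight G (s v c) (s v (!c)) := by
  rintro ⟨hab, ht⟩
  obtain ⟨p, hp⟩ := h.exists_partner hv c
  obtain ⟨q, hq⟩ := h.exists_partner hv (!c)
  have hpG : G.Adj _ p := h.max.1.1 _ hp
  have hpv : p ≠ v := by
    rintro rfl
    exact h.missed p hv _ hp (by simp)
  have hpc : p ≠ s v (!c) := by
    rintro rfl
    exact h.not_mem_pair hv c hp
  have hvc := h.adj v hv c
  have hvc' := h.adj v hv (!c)
  rcases ht with ht | ht | ⟨d, h1, h2, h3, h4⟩
  · exact hpc (ht p hpG)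
  · exact hvc.ne (ht v hvc'.symm)
  · have e1 := (h3 p hpG).resolve_left hpc
    have e2 := (h3 v hvc.symm).resolve_left hvc'.ne
    exact hpv (e1.trans e2.symm)

/-- An edge outside `F` meets `Y` or joins a pair, and neither kind is tight. Thus `F` depends only
on `G`. -/
lemma Extremal.tight_iff (h : Extremal G F Y s) {a b : V} : Tight G a b ↔ s(a, b) ∈ F := by
  refine ⟨fun ht => ?_, h.tight_of_mem⟩
  by_contra hF
  by_cases ha : a ∈ Y
  · exact h.not_tight_of_mem_left ha ht
  by_cases hb : b ∈ Y
  · exact h.not_tight_of_mem_left hb ht.symm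
  obtain ⟨v, hv, c, rfl, rfl⟩ := h.exists_eq_pair ht.1 hF ha hb
  exact h.not_tight_pair hv c ht

lemma Extremal.missed_of_not_covered (h : Extremal G F Y s) {v : V} (hv : ¬ Covered G v) :
    ∀ e ∈ F, v ∉ e := by
  rintro e he ⟨x, rfl⟩
  exact hv ⟨x, h.tight_of_mem he⟩

/-- A free vertex is missed by `F`. If it were not in `Y`, its edge to a neighbour would join a
pair, whose vertices are covered. -/
lemma Extremal.free_iff (h : Extremal G F Y s) {v : V} : Free G v ↔ v ∈ Y := by
  constructor
  · rintro ⟨⟨x, hx⟩, hc⟩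
    obtain ⟨p, hp⟩ := h.max.exists_partner (h.missed_of_not_covered hc) hx
    by_contra hv
    obtain ⟨w, hw, c, rfl, -⟩ := h.exists_eq_pair hx (fun hm => hc ⟨x, h.tight_of_mem hm⟩) hv
      (h.notMem_of_mem hp)
    obtain ⟨q, hq⟩ := h.exists_partner hw c
    exact hc ⟨q, h.tight_of_mem hq⟩
  · exact fun hv => ⟨⟨_, h.adj v hv true⟩, fun ⟨b, hb⟩ => h.not_tight_of_mem_left hv hb⟩

lemma Extremal.locallyGood (h : Extremal G F Y s) : LocallyGood G := by
  refine ⟨fun a b c hb hc => ?_, fun a b hab => ?_, fun a b hab ht ha hb => ?_⟩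
  · rw [h.tight_iff] at hb hc
    exact h.max.1.right_unique hb hc
  · by_cases ha : Covered G a
    · exact Or.inl ha
    · obtain ⟨p, hp⟩ := h.max.exists_partner (h.missed_of_not_covered ha) hab
      exact Or.inr ⟨p, h.tight_of_mem hp⟩
  · obtain ⟨v, hv, c, rfl, rfl⟩ := h.exists_eq_pair hab (fun hm => ht (h.tight_of_mem hm))
      (fun h' => (h.free_iff.2 h').2 ha) (fun h' => (h.free_iff.2 h').2 hb)
    exact ⟨v, h.free_iff.2 hv, h.adj v hv _, h.adj v hv _, fun x hx => h.eq_or_eq_of_adj hv hab hx⟩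

lemma Extremal.hasSystem (h : Extremal G F Y s) : HasSystem G := by
  refine ⟨s, fun v b hv => h.adj v (h.free_iff.1 hv) b, fun v b w c hv hw e => ?_⟩
  rw [h.free_iff] at hv hw
  rcases e with e | e
  · exact h.injective hv hw e
  · exact h.distinct v hv w hw b c _ (h.tight_iff.1 e) (by simp) (by simp)

end Necessity

/-- The characterization of the graphs with `L = 2 l`. -/
theorem bigL_eq_two_mul_smallL_iff : bigL G = 2 * smallL G ↔ LocallyGood G ∧ HasSystem G := by
  refine ⟨fun hL => ?_, fun h => h.1.bigL_eq h.2⟩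
  obtain ⟨F', H, hF', hH, hHF', hc⟩ := exists_bigL G
  obtain ⟨F, hF, hl⟩ := exists_smallL G
  obtain ⟨Y, s, h⟩ := exists_extremal hF hF' hH hHF' hl (hc.trans hL)
  exact ⟨h.locallyGood, h.hasSystem⟩

end MatchingPairs

/-! ### Bipartite matching by auction -/

/-- A function that changes nothing or increases a potential; iterated along a list. -/
lemma foldl_fixed_or_lt {ι σ : Type*} (Φ : σ → ℕ) (g : σ → ι → σ)
    (hg : ∀ i s, g s i = s ∨ Φ s < Φ (g s i)) (l : List ι) (s : σ) :
    (l.foldl g s = s ∧ ∀ i ∈ l, g s i = s) ∨ Φ s < Φ (l.foldl g s) := by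
  induction l generalizing s with
  | nil => simp
  | cons i l ih =>
    rw [List.foldl_cons]
    rcases hg i s with h | h
    · rw [h]
      rcases ih s with h' | h'
      · exact Or.inl ⟨h'.1, by simpa [h] using h'.2⟩
      · exact Or.inr h'
    · rcases ih (g s i) with h' | h'
      · rw [h'.1]
        exact Or.inr h
      · exact Or.inr (h.trans h')

lemma iterate_fixed_or_le {σ : Type*} (Φ : σ → ℕ) (g : σ → σ)
    (hg : ∀ s, g s = s ∨ Φ s < Φ (g s)) (s : σ) (T : ℕ) :
    g (g^[T] s) = g^[T] s ∨ T ≤ Φ (g^[T] s) := by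
  induction T with
  | zero => simp
  | succ T ih =>
    rw [Function.iterate_succ_apply']
    rcases ih with h | h
    · rw [h]
      exact Or.inl h
    · rcases hg (g^[T] s) with h' | h'
      · rw [h']
        exact Or.inl h'
      · exact Or.inr (by omega)

lemma foldl_invariant {ι σ : Type*} (p : σ → Prop) (g : σ → ι → σ) (hg : ∀ i s, p s → p (g s i))
    (l : List ι) (s : σ) (hs : p s) : p (l.foldl g s) := by
  induction l generalizing s with
  | nil => exact hs
  | cons i l ih => exact ih _ (hg i s hs)

/-- The state of the auction: the owner and the price of each object. -/
@[ext] structure Auction (L R : Type*) where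
  own : R → Option L
  price : R → ℕ

namespace Auction

variable {L R : Type*} [DecidableEq R] (E : L → R → Prop)

/-- The bidder `l` owns nothing, and `f` is a cheapest object that `l` can use. -/
def CanBid (s : Auction L R) (l : L) (f : R) : Prop :=
  (∀ g, s.own g ≠ some l) ∧ E l f ∧ ∀ g, E l g → s.price f ≤ s.price g

open Classical in
/-- If it is admissible, then `l` takes `f` and increases its price. -/
noncomputable def bid (l : L) (s : Auction L R) (f : R) : Auction L R :=
  if CanBid E s l f then
    ⟨Function.update s.own f (some l), Function.update s.price f (s.price f + 1)⟩
  else s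

/-- The bidder `l` tries all objects in turn. -/
noncomputable def pass (Rs : List R) (s : Auction L R) (l : L) : Auction L R :=
  Rs.foldl (bid E l) s

/-- All bidders try all objects in turn. -/
noncomputable def sweep (Ls : List L) (Rs : List R) (s : Auction L R) : Auction L R :=
  Ls.foldl (pass E Rs) s

/-- The initial state. -/
def start : Auction L R := ⟨fun _ => none, fun _ => 0⟩

/-- The invariant of the auction. -/
structure Inv (s : Auction L R) : Prop where
  edge : ∀ f l, s.own f = some l → E l f
  unique : ∀ f g l, s.own f = some l → s.own g = some l → f = g
  price_eq_zero : ∀ f, s.own f = none → s.price f = 0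
  price_le : ∀ f l, s.own f = some l → ∀ g, E l g → s.price f ≤ s.price g + 1

variable {E}

lemma inv_start : Inv E (start : Auction L R) := by
  constructor <;> simp [start]

lemma Inv.bid {s : Auction L R} (h : Inv E s) (l : L) (f : R) : Inv E (bid E l s f) := by
  unfold Auction.bid
  split_ifs with hb
  · obtain ⟨h1, h2, h3⟩ := hb
    have hmono : ∀ g, s.price g ≤ Function.update s.price f (s.price f + 1) g := fun g => by
      by_cases hg : g = f
      · subst hg; simp
      · simp [hg]
    constructor
    · intro g k hk
      by_cases hg : g = f
      · subst hg
        simp only [Function.update_self, Option.some.injEq] at hk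
        exact hk ▸ h2
      · simp only [Function.update_of_ne hg] at hk
        exact h.edge g k hk
    · intro g g' k hk hk'
      simp only [Function.update_apply] at hk hk'
      have := h.unique g g' k
      grind
    · intro g hg
      by_cases hgf : g = f
      · subst hgf; simp at hg
      · simp only [Function.update_of_ne hgf] at hg ⊢
        exact h.price_eq_zero g hg
    · intro g k hk g' hE
      by_cases hgf : g = f
      · subst hgf
        simp only [Function.update_self, Option.some.injEq] at hk ⊢
        subst hk
        exact Nat.succ_le_succ ((h3 g' hE).trans (hmono g'))
      · simp only [Function.update_of_ne hgf] at hk ⊢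
        exact (h.price_le g k hk g' hE).trans (Nat.succ_le_succ (hmono g'))
  · exact h

variable [Fintype R]

/-- The sum of the prices. -/
def total (s : Auction L R) : ℕ := ∑ f, s.price f

lemma total_lt_of_canBid {s : Auction L R} {l : L} {f : R} (h : CanBid E s l f) :
    s.total < (bid E l s f).total := by
  rw [Auction.bid, if_pos h]
  refine Finset.sum_lt_sum (fun g _ => ?_) ⟨f, Finset.mem_univ _, by simp⟩
  by_cases hg : g = f
  · subst hg; simp
  · simp [hg]

lemma bid_fixed_or_lt (l : L) (f : R) (s : Auction L R) :
    bid E l s f = s ∨ s.total < (bid E l s f).total := by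
  by_cases h : CanBid E s l f
  · exact Or.inr (total_lt_of_canBid h)
  · exact Or.inl (by rw [Auction.bid, if_neg h])

lemma pass_fixed_or_lt (Rs : List R) (l : L) (s : Auction L R) :
    (pass E Rs s l = s ∧ ∀ f ∈ Rs, bid E l s f = s) ∨ s.total < (pass E Rs s l).total :=
  foldl_fixed_or_lt total _ (fun f s => bid_fixed_or_lt l f s) Rs s

lemma sweep_fixed_or_lt (Ls : List L) (Rs : List R) (s : Auction L R) :
    (sweep E Ls Rs s = s ∧ ∀ l ∈ Ls, pass E Rs s l = s) ∨ s.total < (sweep E Ls Rs s).total :=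
  foldl_fixed_or_lt total _ (fun l s => (pass_fixed_or_lt Rs l s).imp_left And.left) Ls s

/-- A bidder without an object could bid for a cheapest usable one; this raises the total price, so
the sweep would have changed the state. -/
lemma exists_own_of_fixed {Ls : List L} {Rs : List R} {s : Auction L R}
    (hL : ∀ l, l ∈ Ls) (hR : ∀ f, f ∈ Rs) (hs : sweep E Ls Rs s = s) {l : L} {f : R}
    (hlf : E l f) : ∃ g, s.own g = some l := by
  classical
  by_contra! hcon
  obtain ⟨f, hf, hmin⟩ := Finset.exists_min_image (Finset.univ.filter (E l)) s.price
    ⟨f, by simpa using hlf⟩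
  have hc : CanBid E s l f := ⟨hcon, by simpa using hf, by simpa using hmin⟩
  rcases sweep_fixed_or_lt Ls Rs s with ⟨-, h⟩ | h
  · rcases pass_fixed_or_lt Rs l s with ⟨-, h'⟩ | h'
    · have := total_lt_of_canBid hc
      rw [h' f (hR f)] at this
      exact lt_irrefl _ this
    · rw [h l (hL l)] at h'
      exact lt_irrefl _ h'
  · rw [hs] at h
    exact lt_irrefl _ h

variable [Fintype L]

/-- If all bidders in `need` can be served, then the prices stay below the number of bidders. -/
lemma Inv.price_lt {s : Auction L R} (h : Inv E s) {need : L → Prop} (hE : ∀ l f, E l f → need l)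
    {m : L → R} (hm : ∀ l, need l → E l (m l)) (hi : ∀ l k, need l → need k → m l = m k → l = k)
    {l : L} (hl : need l) (hown : ∀ g, s.own g ≠ some l) : s.price (m l) < Fintype.card L := by
  classical
  by_contra! hcon
  -- Starting from `{l}`, pass from `S` to the owners of the objects `m k`, `k ∈ S`, together with
  -- `l`. The prices involved are still positive, so owners exist; they are distinct and differ from
  -- `l`, so the set grows by one. An owner's own object `m o` is cheaper by at most one. After
  -- `|L|` rounds the set has more than `|L|` elements.
  have key : ∀ i ≤ Fintype.card L, ∃ S : Finset L, i + 1 ≤ S.card ∧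
      ∀ k ∈ S, need k ∧ Fintype.card L ≤ s.price (m k) + i := by
    intro i
    induction i with
    | zero => exact fun _ => ⟨{l}, by simp, by simpa using ⟨hl, hcon⟩⟩
    | succ i ih =>
      intro hin
      obtain ⟨S, hS, hk⟩ := ih (by omega)
      have howner : ∀ k : L, ∃ o, k ∈ S → s.own (m k) = some o := by
        intro k
        by_cases hkS : k ∈ S
        · cases ho : s.own (m k) with
          | none =>
            have := h.price_eq_zero _ ho
            have := (hk k hkS).2
            omega
          | some o => exact ⟨o, fun _ => rfl⟩
        · exact ⟨k, fun h => absurd h hkS⟩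
      choose o ho using howner
      refine ⟨insert l (S.image o), ?_, ?_⟩
      · rw [Finset.card_insert_of_notMem, Finset.card_image_of_injOn]
        · omega
        · intro k hkS k' hkS' e
          exact hi k k' (hk k hkS).1 (hk k' hkS').1
            (h.unique _ _ _ (ho k hkS) (e ▸ ho k' hkS'))
        · intro hmem
          obtain ⟨k, hkS, e⟩ := Finset.mem_image.1 hmem
          exact hown _ (e ▸ ho k hkS)
      · intro k hkI
        rcases Finset.mem_insert.1 hkI with rfl | hkI
        · exact ⟨hl, by omega⟩
        · obtain ⟨k', hkS, rfl⟩ := Finset.mem_image.1 hkI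
          have hn := hE _ _ (h.edge _ _ (ho k' hkS))
          have := h.price_le _ _ (ho k' hkS) _ (hm _ hn)
          have := (hk k' hkS).2
          exact ⟨hn, by omega⟩
  obtain ⟨S, hS, -⟩ := key _ le_rfl
  have := Finset.card_le_univ S
  omega

/-- After sufficiently many sweeps, all bidders in `need` own an object if and only if they can be
served simultaneously. -/
theorem iterate_sweep_iff [Nonempty R] {need : L → Prop} (hE : ∀ l f, E l f → need l) {Ls : List L} {Rs : List R}
    (hL : ∀ l, l ∈ Ls) (hR : ∀ f, f ∈ Rs) {T : ℕ} (hT : Fintype.card R * Fintype.card L < T) :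
    (∀ l, need l → ∃ f, ((sweep E Ls Rs)^[T] start).own f = some l) ↔
      ∃ m : L → R, (∀ l, need l → E l (m l)) ∧ ∀ l k, need l → need k → m l = m k → l = k := by
  have lift : ∀ (p : Auction L R → Prop), (∀ l f s, p s → p (bid E l s f)) →
      p start → p ((sweep E Ls Rs)^[T] start) := by
    intro p hp h0
    refine Function.Iterate.rec p h0 ?_ T
    exact fun s hs => foldl_invariant p _
      (fun l s hs => foldl_invariant p _ (fun f s hs => hp l f s hs) _ _ hs) _ _ hs
  constructor
  · intro h
    have hinv := lift (Inv E) (fun l f s hs => hs.bid l f) inv_start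
    generalize (sweep E Ls Rs)^[T] start = s at h hinv
    choose! m hm using h
    exact ⟨m, fun l hl => hinv.edge _ _ (hm l hl), fun l k hl hk e => by
      have h1 := hm l hl
      rw [e, hm k hk] at h1
      exact (Option.some.inj h1).symm⟩
  · rintro ⟨m, hm, hi⟩ l hl
    -- A bid goes to a cheapest usable object, whose price is at most that of `m l` and hence below
    -- `|L|` before the increase.
    have hinv := lift (fun s => Inv E s ∧ ∀ f, s.price f ≤ Fintype.card L) (by
      rintro l f s ⟨hs, hp⟩
      refine ⟨hs.bid l f, ?_⟩
      unfold Auction.bid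
      split_ifs with hb
      · intro g
        by_cases hg : g = f
        · subst hg
          have hl := hE _ _ hb.2.1
          have h1 := hs.price_lt hE hm hi hl hb.1
          have h2 := hb.2.2 _ (hm l hl)
          simp only [Function.update_self]
          omega
        · simpa [hg] using hp g
      · exact hp) ⟨inv_start, by simp [start]⟩
    rcases iterate_fixed_or_le total (sweep E Ls Rs)
      (fun s => (sweep_fixed_or_lt Ls Rs s).imp_left And.left) start T with h | h
    · exact exists_own_of_fixed hL hR h (hm l hl)
    -- Without a fixed point the total price would be at least `T`, beyond what the price bound
    -- allows.
    · have : total ((sweep E Ls Rs)^[T] start) ≤ Fintype.card R * Fintype.card L := by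
        refine (Finset.sum_le_card_nsmul _ _ _ fun f _ => hinv.2 f).trans ?_
        simp
      omega

end Auction

namespace MatchingPairs

/-! ### Systems of neighbours as matchings of a bipartite graph -/

/-- The copies of a free vertex `v` can use the tight edges at the neighbours of `v`; a tight edge is
represented by its smaller end. -/
def Usable {n : ℕ} (G : SimpleGraph (Fin n)) (l : Fin n × Bool) (f : Fin n) : Prop :=
  Free G l.1 ∧ ∃ g, Tight G f g ∧ f < g ∧ (G.Adj l.1 f ∨ G.Adj l.1 g)

/-- In a locally good graph every neighbour of a free vertex lies on exactly one tight edge, and two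
such neighbours are equal or joined by a tight edge exactly when these tight edges coincide. So
choosing neighbours amounts to choosing distinct tight edges, and back. -/
lemma LocallyGood.hasSystem_iff {n : ℕ} {G : SimpleGraph (Fin n)} (h : LocallyGood G) :
    HasSystem G ↔ ∃ m : Fin n × Bool → Fin n, (∀ l, Free G l.1 → Usable G l (m l)) ∧
      ∀ l k, Free G l.1 → Free G k.1 → m l = m k → l = k := by
  constructor
  · rintro ⟨s, hs, hd⟩
    have hp : ∀ l : Fin n × Bool, ∃ p, Free G l.1 → Tight G (s l.1 l.2) p := by
      intro l
      by_cases hl : Free G l.1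
      · obtain ⟨p, hp⟩ := (h.2.1 _ _ (hs l.1 l.2 hl)).resolve_left hl.2
        exact ⟨p, fun _ => hp⟩
      · exact ⟨l.1, fun h => absurd h hl⟩
    choose p hp using hp
    refine ⟨fun l => min (s l.1 l.2) (p l), fun l hl => ⟨hl, ?_⟩, ?_⟩
    · have ht := hp l hl
      have ha := hs l.1 l.2 hl
      simp only
      rcases lt_or_gt_of_ne ht.1.ne with hlt | hlt
      · rw [min_eq_left hlt.le]
        exact ⟨p l, ht, hlt, Or.inl ha⟩
      · rw [min_eq_right hlt.le]
        exact ⟨_, ht.symm, hlt, Or.inr ha⟩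
    · rintro ⟨v, b⟩ ⟨w, c⟩ hv hw e
      have hv' := hp _ hv
      have hw' := hp _ hw
      suffices s v b = s w c ∨ Tight G (s v b) (s w c) by
        obtain ⟨rfl, rfl⟩ := hd v b w c hv hw this
        rfl
      simp only at e hv' hw'
      rcases min_choice (s v b) (p (v, b)) with e1 | e1 <;>
        rcases min_choice (s w c) (p (w, c)) with e2 | e2 <;> rw [e1, e2] at e
      · exact Or.inl e
      · exact Or.inr (e ▸ hw'.symm)
      · exact Or.inr (e ▸ hv')
      · rw [e] at hv'
        exact Or.inl (h.1 _ _ _ hv'.symm hw'.symm)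
  · rintro ⟨m, hm, hi⟩
    have hex : ∀ l : Fin n × Bool, ∃ x, Free G l.1 → G.Adj l.1 x ∧
        ∃ g, Tight G (m l) g ∧ m l < g ∧ (x = m l ∨ x = g) := by
      intro l
      by_cases hl : Free G l.1
      · obtain ⟨-, g, ht, hlt, ha | ha⟩ := hm l hl
        · exact ⟨_, fun _ => ⟨ha, g, ht, hlt, Or.inl rfl⟩⟩
        · exact ⟨_, fun _ => ⟨ha, g, ht, hlt, Or.inr rfl⟩⟩
      · exact ⟨l.1, fun h => absurd h hl⟩
    choose x hx using hex
    refine ⟨fun v b => x (v, b), fun v b hv => (hx (v, b) hv).1, ?_⟩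
    intro v b w c hv hw e
    suffices m (v, b) = m (w, c) by
      have := hi _ _ hv hw this
      simpa using this
    obtain ⟨-, g, h1, h2, h3⟩ := hx (v, b) hv
    obtain ⟨-, g', h1', h2', h3'⟩ := hx (w, c) hw
    simp only at e
    have u := h.1
    have s1 := h1.symm
    have s1' := h1'.symm
    generalize m (v, b) = f at *
    generalize m (w, c) = f' at *
    generalize x (v, b) = y at *
    generalize x (w, c) = y' at *
    -- In each case the two tight edges coincide, and `f < g`, `f' < g'` force equal smaller ends or
    -- a contradiction.
    rcases h3 with rfl | rfl <;> rcases h3' with rfl | rfl <;> rcases e with rfl | e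
    · rfl
    · have := u _ _ _ e h1
      subst this
      have := u _ _ _ h1' s1
      subst this
      exact absurd h2 h2'.not_gt
    · have := u _ _ _ s1' h1
      subst this
      exact absurd h2 h2'.not_gt
    · have := u _ _ _ e.symm s1'
      exact this
    · have := u _ _ _ s1 h1'
      subst this
      exact absurd h2 h2'.not_gt
    · have := u _ _ _ e s1
      exact this.symm
    · exact u _ _ _ s1 s1'
    · have := u _ _ _ e s1
      subst this
      have := u _ _ _ s1' h1
      subst this
      exact absurd h2 h2'.not_gt

end MatchingPairs

namespace RAM

open MatchingPairs

/-! ### Formulas as expressions -/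

namespace Expr

/-- The expression is true, that is, not zero. -/
def Holds (n : ℕ) (m ρ : ℕ → ℕ) (e : Expr) : Prop := e.eval n m ρ ≠ 0

/-- Negation. -/
def not (e : Expr) : Expr := .ifz e (.const 1) (.const 0)

/-- Conjunction. -/
def and (a b : Expr) : Expr := .ifz a (.const 0) b

/-- Disjunction. -/
def or (a b : Expr) : Expr := .add a b

/-- Implication. -/
def imp (a b : Expr) : Expr := .ifz a (.const 1) b

/-- Existential quantifier over the numbers below the input size. -/
def ex (x : ℕ) (e : Expr) : Expr := .sum x e

/-- Universal quantifier over the numbers below the input size. -/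
def all (x : ℕ) (e : Expr) : Expr := not (ex x (not e))

/-- Equality. -/
def eq (a b : Expr) : Expr := not (.add (.sub a b) (.sub b a))

/-- Strict inequality. -/
def lt (a b : Expr) : Expr := .sub b a

/-- Inequality. -/
def le (a b : Expr) : Expr := not (.sub a b)

variable {n : ℕ} {m ρ : ℕ → ℕ}

@[simp] lemma holds_not (e : Expr) : Holds n m ρ (not e) ↔ ¬ Holds n m ρ e := by
  simp [Holds, not, eval]

@[simp] lemma holds_and (a b : Expr) :
    Holds n m ρ (and a b) ↔ Holds n m ρ a ∧ Holds n m ρ b := by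
  simp [Holds, and, eval]

@[simp] lemma holds_or (a b : Expr) :
    Holds n m ρ (or a b) ↔ Holds n m ρ a ∨ Holds n m ρ b := by
  simp only [Holds, or, eval]
  omega

@[simp] lemma holds_imp (a b : Expr) :
    Holds n m ρ (imp a b) ↔ (Holds n m ρ a → Holds n m ρ b) := by
  simp only [Holds, imp, eval]
  split_ifs with h <;> simp [h]

@[simp] lemma holds_ex (x : ℕ) (e : Expr) :
    Holds n m ρ (ex x e) ↔ ∃ i : Fin n, Holds n m (Function.update ρ x i) e := by
  simp only [Holds, ex, eval, ne_eq, Finset.sum_eq_zero_iff, Finset.mem_range, not_forall]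
  exact ⟨fun ⟨i, hi, h⟩ => ⟨⟨i, hi⟩, h⟩, fun ⟨i, h⟩ => ⟨i, i.2, h⟩⟩

@[simp] lemma holds_all (x : ℕ) (e : Expr) :
    Holds n m ρ (all x e) ↔ ∀ i : Fin n, Holds n m (Function.update ρ x i) e := by
  simp [all]

@[simp] lemma holds_eq (a b : Expr) : Holds n m ρ (eq a b) ↔ a.eval n m ρ = b.eval n m ρ := by
  rw [eq, holds_not, Holds]
  simp only [eval]
  omega

@[simp] lemma holds_lt (a b : Expr) : Holds n m ρ (lt a b) ↔ a.eval n m ρ < b.eval n m ρ := by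
  simp only [lt, Holds, eval]
  omega

@[simp] lemma holds_le (a b : Expr) : Holds n m ρ (le a b) ↔ a.eval n m ρ ≤ b.eval n m ρ := by
  rw [le, holds_not, Holds]
  simp only [eval]
  omega

/-- Adjacency of two vertices; the variable `0` is used for the computation of the address. -/
def adj (x y : ℕ) : Expr := .read (.add (.sum 0 (.var x)) (.var y))

/-- Tightness of an edge, with bound variables from `z` on. -/
def tight (x y z : ℕ) : Expr :=
  and (adj x y) (or (all z (imp (adj x z) (eq (.var z) (.var y))))
    (or (all z (imp (adj y z) (eq (.var z) (.var x))))
      (ex z (and (adj x z) (and (adj y z) (and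
        (all (z + 1) (imp (adj x (z + 1))
          (or (eq (.var (z + 1)) (.var y)) (eq (.var (z + 1)) (.var z)))))
        (all (z + 1) (imp (adj y (z + 1))
          (or (eq (.var (z + 1)) (.var x)) (eq (.var (z + 1)) (.var z)))))))))))

/-- The vertex `x` lies on a tight edge; with bound variables from `z` on. -/
def covered (x z : ℕ) : Expr := ex z (tight x z (z + 1))

/-- The vertex `x` is free; with bound variables from `z` on. -/
def free (x z : ℕ) : Expr := and (ex z (adj x z)) (not (covered x z))

/-- The graph is locally good. -/
def good : Expr :=
  and (all 1 (all 2 (all 3 (imp (tight 1 2 4) (imp (tight 1 3 4) (eq (.var 2) (.var 3)))))))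
    (and (all 1 (all 2 (imp (adj 1 2) (or (covered 1 4) (covered 2 4)))))
      (all 1 (all 2 (imp (adj 1 2) (imp (not (tight 1 2 4)) (imp (covered 1 4) (imp (covered 2 4)
        (ex 3 (and (free 3 4) (and (adj 3 1) (and (adj 3 2)
          (all 4 (imp (adj 3 4) (or (eq (.var 4) (.var 1)) (eq (.var 4) (.var 2))))))))))))))))

/-- The copies of the vertex `x` can use the tight edge with smaller end `y`; with bound variables
from `z` on. -/
def usable (x y z : ℕ) : Expr :=
  and (free x z) (ex z (and (tight y z (z + 1))
    (and (lt (.var y) (.var z)) (or (adj x y) (adj x z)))))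

/-- The memory `m` starts with the adjacency matrix of `G`. -/
def HasGraph (G : SimpleGraph (Fin n)) (m : ℕ → ℕ) : Prop :=
  ∀ i j : Fin n, m (n * i + j) ≠ 0 ↔ G.Adj i j

variable {G : SimpleGraph (Fin n)}

/-- Summing the value of `x` over all numbers below `n` replaces the multiplication by `n`. The sum
binds the variable `0`, hence `hx0`. -/
lemma holds_adj (hm : HasGraph G m) {x y : ℕ} {a b : Fin n} (hx : ρ x = a) (hy : ρ y = b)
    (hx0 : x ≠ 0) : Holds n m ρ (adj x y) ↔ G.Adj a b := by
  rw [← hm a b]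
  simp [Holds, adj, eval, hx0, hx, hy]

lemma holds_tight (hm : HasGraph G m) {x y z : ℕ} {a b : Fin n} (hx : ρ x = a) (hy : ρ y = b)
    (hx0 : x ≠ 0) (hy0 : y ≠ 0) (hxz : x < z) (hyz : y < z) :
    Holds n m ρ (tight x y z) ↔ Tight G a b := by
  have h1 : x ≠ z + 1 := by omega
  have h2 : y ≠ z + 1 := by omega
  simp only [tight, Tight, holds_and, holds_or, holds_all, holds_ex, holds_imp, holds_eq]
  refine and_congr (holds_adj hm hx hy hx0) (or_congr (forall_congr' fun i => ?_)
    (or_congr (forall_congr' fun i => ?_) (exists_congr fun i => and_congr ?_ (and_congr ?_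
      (and_congr (forall_congr' fun j => ?_) (forall_congr' fun j => ?_))))))
  · refine imp_congr (holds_adj hm (by simp [hxz.ne, hx]) (by simp) hx0) ?_
    simp [eval, hyz.ne, hy, Fin.ext_iff]
  · refine imp_congr (holds_adj hm (by simp [hyz.ne, hy]) (by simp) hy0) ?_
    simp [eval, hxz.ne, hx, Fin.ext_iff]
  · exact holds_adj hm (by simp [hxz.ne, hx]) (by simp) hx0
  · exact holds_adj hm (by simp [hyz.ne, hy]) (by simp) hy0
  · refine imp_congr (holds_adj hm (by simp [h1, hxz.ne, hx]) (by simp) hx0) ?_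
    simp [eval, hyz.ne, h2, hy, Fin.ext_iff]
  · refine imp_congr (holds_adj hm (by simp [h2, hyz.ne, hy]) (by simp) hy0) ?_
    simp [eval, hxz.ne, h1, hx, Fin.ext_iff]

lemma holds_covered (hm : HasGraph G m) {x z : ℕ} {a : Fin n} (hx : ρ x = a) (hx0 : x ≠ 0)
    (hxz : x < z) : Holds n m ρ (covered x z) ↔ Covered G a := by
  simp only [covered, Covered, holds_ex]
  exact exists_congr fun i => holds_tight hm (by simp [hxz.ne, hx]) (by simp) hx0 (by omega)
    (by omega) (by omega)

lemma holds_free (hm : HasGraph G m) {x z : ℕ} {a : Fin n} (hx : ρ x = a) (hx0 : x ≠ 0)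
    (hxz : x < z) : Holds n m ρ (free x z) ↔ Free G a := by
  simp only [free, Free, holds_and, holds_not, holds_ex]
  exact and_congr (exists_congr fun i => holds_adj hm (by simp [hxz.ne, hx]) (by simp) hx0)
    (not_congr (holds_covered hm hx hx0 hxz))

lemma holds_usable (hm : HasGraph G m) {x y z : ℕ} {a b : Fin n} (c : Bool) (hx : ρ x = a)
    (hy : ρ y = b) (hx0 : x ≠ 0) (hy0 : y ≠ 0) (hxz : x < z) (hyz : y < z) :
    Holds n m ρ (usable x y z) ↔ Usable G (a, c) b := by
  simp only [usable, Usable, holds_and, holds_or, holds_lt, holds_ex]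
  refine and_congr (holds_free hm hx hx0 hxz) (exists_congr fun i => and_congr ?_ (and_congr ?_
    (or_congr ?_ ?_)))
  · exact holds_tight hm (by simp [hyz.ne, hy]) (by simp) hy0 (by omega) (by omega) (by omega)
  · simp [eval, hyz.ne, hy]
  · exact holds_adj hm (by simp [hxz.ne, hx]) (by simp [hyz.ne, hy]) hx0
  · exact holds_adj hm (by simp [hxz.ne, hx]) (by simp) hx0

lemma holds_good (hm : HasGraph G m) : Holds n m ρ good ↔ LocallyGood G := by
  simp only [good, LocallyGood, holds_and, holds_or, holds_all, holds_ex, holds_imp, holds_eq,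
    holds_not]
  refine and_congr ?_ (and_congr ?_ ?_)
  · refine forall_congr' fun a => forall_congr' fun b => forall_congr' fun c => ?_
    refine imp_congr ?_ (imp_congr ?_ ?_)
    · exact holds_tight hm (by simp) (by simp) (by simp) (by simp) (by simp) (by simp)
    · exact holds_tight hm (by simp) (by simp) (by simp) (by simp) (by simp) (by simp)
    · simp [eval, Fin.ext_iff]
  · refine forall_congr' fun a => forall_congr' fun b => imp_congr ?_ (or_congr ?_ ?_)
    · exact holds_adj hm (by simp) (by simp) (by simp)
    · exact holds_covered hm (by simp) (by simp) (by simp)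
    · exact holds_covered hm (by simp) (by simp) (by simp)
  · refine forall_congr' fun a => forall_congr' fun b => imp_congr ?_ (imp_congr (not_congr ?_)
      (imp_congr ?_ (imp_congr ?_ (exists_congr fun v => and_congr ?_ (and_congr ?_ (and_congr ?_
        (forall_congr' fun x => imp_congr ?_ ?_)))))))
    · exact holds_adj hm (by simp) (by simp) (by simp)
    · exact holds_tight hm (by simp) (by simp) (by simp) (by simp) (by simp) (by simp)
    · exact holds_covered hm (by simp) (by simp) (by simp)
    · exact holds_covered hm (by simp) (by simp) (by simp)
    · exact holds_free hm (by simp) (by simp) (by simp)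
    · exact holds_adj hm (by simp) (by simp) (by simp)
    · exact holds_adj hm (by simp) (by simp) (by simp)
    · exact holds_adj hm (by simp) (by simp) (by simp)
    · simp [eval, Fin.ext_iff]

/-! ### The auction as a command -/

/-- The address of the owner of the object `x`. -/
def ownAddr (x : ℕ) : Expr := .add (.sum 0 .size) (.var x)

/-- The address of the price of the object `x`. -/
def priceAddr (x : ℕ) : Expr := .add (.add (.sum 0 .size) .size) (.var x)

/-- The code of the copy `b` of the vertex `x`. -/
def bidder (b : Bool) (x : ℕ) : Expr := .add (.add (.var x) (.var x)) (.const (b.toNat + 1))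

/-- The copy `b` of the vertex `1` owns an object. -/
def owns (b : Bool) : Expr := ex 3 (eq (.read (ownAddr 3)) (bidder b 1))

/-- The copy `b` of the vertex `1` can bid for the object `2`. -/
def canBid (b : Bool) : Expr :=
  and (not (owns b)) (and (usable 1 2 4)
    (all 3 (imp (usable 1 3 4) (le (.read (priceAddr 2)) (.read (priceAddr 3))))))

/-- The graph is locally good, and all copies of free vertices own objects. -/
def accept : Expr :=
  .ifz (and good (all 1 (imp (free 1 4) (and (owns false) (owns true))))) (.const 0) (.const 1)

end Expr

namespace Cmd

open RAM.Expr

/-- The copy `b` of the vertex `1` bids for the object `2`. -/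
def bid (b : Bool) : Cmd :=
  .when (canBid b) (.seq (.store (ownAddr 2) (bidder b 1))
    (.store (priceAddr 2) (.add (.read (priceAddr 2)) (.const 1))))

/-- All copies bid for all objects. -/
def sweep : Cmd := .loop 1 (.seq (.loop 2 (bid false)) (.loop 2 (bid true)))

/-- The auction. -/
def auction : Cmd := .loop 1 (.loop 1 (.seq sweep (.seq sweep sweep)))

end Cmd

/-! ### Correctness of the auction program -/

section Auction

open RAM.Expr

variable {n : ℕ} {G : SimpleGraph (Fin n)} {m ρ : ℕ → ℕ}

/-- The representation of the owner of an object in the memory. -/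
def ownerCode : Option (Fin n × Bool) → ℕ
  | none => 0
  | some l => (l.1 + l.1) + (l.2.toNat + 1)

/-- The copies of `k` have the codes `2k + 1` and `2k + 2`, which leaves `0` for objects without an
owner. -/
lemma ownerCode_eq_iff (o : Option (Fin n × Bool)) (k : Fin n) (b : Bool) :
    ownerCode o = k + k + (b.toNat + 1) ↔ o = some (k, b) := by
  rcases o with _ | ⟨k', b'⟩
  · simp [ownerCode]
  · simp only [ownerCode, Option.some.injEq, Prod.mk.injEq, Fin.ext_iff]
    cases b <;> cases b' <;> simp <;> omega

/-- The memory `m` holds the graph `G` and the state `s` of the auction. -/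
structure Represents (G : SimpleGraph (Fin n)) (m : ℕ → ℕ) (s : Auction (Fin n × Bool) (Fin n)) :
    Prop where
  graph : HasGraph G m
  own : ∀ f : Fin n, m (n * n + f) = ownerCode (s.own f)
  price : ∀ f : Fin n, m (n * n + n + f) = s.price f

variable {s : Auction (Fin n × Bool) (Fin n)}

lemma Represents.holds_owns (h : Represents G m s) {k : Fin n} (hk : ρ 1 = k) (b : Bool) :
    Holds n m ρ (owns b) ↔ ∃ f, s.own f = some (k, b) := by
  simp only [owns, holds_ex, holds_eq]
  refine exists_congr fun f => ?_
  rw [← ownerCode_eq_iff, ← h.own]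
  simp [eval, ownAddr, bidder, hk]

lemma Represents.holds_canBid (h : Represents G m s) {k f : Fin n} (hk : ρ 1 = k) (hf : ρ 2 = f)
    (b : Bool) : Holds n m ρ (canBid b) ↔ Auction.CanBid (Usable G) s (k, b) f := by
  simp only [canBid, Auction.CanBid, holds_and, holds_not, holds_all, holds_imp, holds_le,
    h.holds_owns hk, not_exists]
  refine and_congr Iff.rfl (and_congr ?_ (forall_congr' fun g => imp_congr ?_ ?_))
  · exact holds_usable h.graph b hk hf (by simp) (by simp) (by simp) (by simp)
  · exact holds_usable h.graph b (by simp [hk]) (by simp) (by simp) (by simp) (by simp) (by simp)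
  · rw [← h.price, ← h.price]
    simp [eval, priceAddr, hf]

lemma Represents.bid (h : Represents G m s) {k f : Fin n} (hk : ρ 1 = k) (hf : ρ 2 = f)
    (b : Bool) : Represents G ((Cmd.bid b).eval n ρ m) (Auction.bid (Usable G) (k, b) s f) := by
  have hc := h.holds_canBid hk hf b
  unfold Holds at hc
  by_cases hb : Auction.CanBid (Usable G) s (k, b) f
  · rw [Auction.bid, if_pos hb]
    have e : (Cmd.bid b).eval n ρ m = Function.update (Function.update m (n * n + f)
        (ownerCode (some (k, b)))) (n * n + n + f) (s.price f + 1) := by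
      have hne : n * n + n + (f : ℕ) ≠ n * n + f := by have := f.2; omega
      rw [← h.price]
      simp [Cmd.bid, Cmd.eval, hc.2 hb, eval, ownAddr, priceAddr, bidder, hk, hf, ownerCode,
        Function.update_of_ne hne]
    rw [e]
    -- The adjacency matrix, the owners and the prices occupy consecutive disjoint blocks of lengths
    -- `n * n`, `n` and `n`.
    constructor
    · intro i j
      have hi := i.2
      have hj := j.2
      have h1 : n * i + j < n * n := by nlinarith
      rw [Function.update_of_ne (by omega), Function.update_of_ne (by omega)]
      exact h.graph i j
    · intro g
      have hg := g.2
      rw [Function.update_of_ne (by omega)]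
      by_cases hgf : g = f
      · subst hgf; simp
      · have : (g : ℕ) ≠ f := fun e => hgf (Fin.ext e)
        rw [Function.update_of_ne (by omega)]
        simp [hgf, h.own]
    · intro g
      have hg := g.2
      by_cases hgf : g = f
      · subst hgf; simp
      · have : (g : ℕ) ≠ f := fun e => hgf (Fin.ext e)
        have := f.2
        rw [Function.update_of_ne (by omega), Function.update_of_ne (by omega)]
        simp [hgf, h.price]
  · rw [Auction.bid, if_neg hb]
    have : (Cmd.bid b).eval n ρ m = m := by
      simp only [Cmd.bid, Cmd.eval]
      rw [if_pos]
      exact not_not.1 (mt hc.1 hb)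
    rw [this]
    exact h

lemma Cmd.eval_loop (x : ℕ) (c : Cmd) : (Cmd.loop x c).eval n ρ m =
    (List.finRange n).foldl (fun m (i : Fin n) => c.eval n (Function.update ρ x i) m) m := by
  rw [Cmd.eval, ← List.map_coe_finRange_eq_range, List.foldl_map]

lemma Represents.pass (h : Represents G m s) {k : Fin n} (hk : ρ 1 = k) (b : Bool) :
    Represents G ((Cmd.loop 2 (Cmd.bid b)).eval n ρ m)
      (Auction.pass (Usable G) (List.finRange n) s (k, b)) := by
  rw [Cmd.eval_loop]
  exact List.foldl_rel h fun f _ _ _ h' => h'.bid (by simp [hk]) (by simp) b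

/-- The order in which the copies of the vertices bid. -/
def bidders (n : ℕ) : List (Fin n × Bool) :=
  (List.finRange n).flatMap fun k => [(k, false), (k, true)]

lemma mem_bidders (l : Fin n × Bool) : l ∈ bidders n := by
  rcases l with ⟨k, b⟩
  cases b <;> simp [bidders]

lemma Represents.sweep (h : Represents G m s) : Represents G (Cmd.sweep.eval n ρ m)
    (Auction.sweep (Usable G) (bidders n) (List.finRange n) s) := by
  rw [Cmd.sweep, Cmd.eval_loop, Auction.sweep, bidders, List.foldl_flatMap]
  exact List.foldl_rel h fun k _ _ _ h' => (h'.pass (by simp) false).pass (by simp) true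

lemma foldl_iterate {σ ι : Type*} (g : σ → σ) (l : List ι) (s : σ) :
    l.foldl (fun s _ => g s) s = g^[l.length] s := by
  induction l generalizing s with
  | nil => rfl
  | cons i l ih => simp [ih]

lemma Represents.auction (h : Represents G m s) : Represents G (Cmd.auction.eval n ρ m)
    ((Auction.sweep (Usable G) (bidders n) (List.finRange n))^[3 * n * n] s) := by
  set g := Auction.sweep (Usable G) (bidders n) (List.finRange n)
  have e : g^[3 * n * n] s = (List.finRange n).foldl (fun s _ =>
      (List.finRange n).foldl (fun s _ => g (g (g s))) s) s := by
    have : (fun s _ => g (g (g s)) : _ → Fin n → _) = fun s _ => g^[3] s := rfl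
    rw [this]
    simp only [foldl_iterate, ← Function.iterate_mul, List.length_finRange]
  rw [e, Cmd.auction, Cmd.eval_loop]
  refine List.foldl_rel h fun _ _ m' s' h' => ?_
  rw [Cmd.eval_loop]
  exact List.foldl_rel h' fun _ _ m' s' h' => h'.sweep.sweep.sweep

/-- All cells beyond the matrix are `0`, which already encodes no owners and zero prices, so the
program needs no initialization. -/
lemma represents_input (G : SimpleGraph (Fin n)) :
    Represents G (input G).mem Auction.start := by
  have big : ∀ a, n * n ≤ a → (input G).mem a = 0 := by
    intro a ha
    simp only [input]
    rw [if_neg]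
    rintro ⟨i, j, rfl, -⟩
    have hi := i.2
    have hj := j.2
    nlinarith
  constructor
  · intro i j
    simp only [input, ne_eq, ite_eq_right_iff, one_ne_zero, imp_false, not_not]
    constructor
    · rintro ⟨i', j', e, h⟩
      have hj := j.2
      have hj' := j'.2
      have h1 : (i : ℕ) = i' := by
        have := congrArg (· / n) e
        simpa [Nat.mul_add_div (by omega : 0 < n), mul_comm (i' : ℕ) n, Nat.div_eq_of_lt hj,
          Nat.div_eq_of_lt hj'] using this
      have h2 : (j : ℕ) = j' := by
        rw [h1, mul_comm] at e
        omega
      rwa [Fin.ext h1, Fin.ext h2]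
    · intro h
      exact ⟨i, j, by rw [mul_comm], h⟩
  · intro f
    rw [big _ (by omega)]
    rfl
  · intro f
    rw [big _ (by omega)]
    rfl

lemma eval_accept (G : SimpleGraph (Fin n)) :
    (bigL G = 2 * smallL G → accept.eval n (Cmd.auction.eval n ρ (input G).mem) ρ = 1) ∧
    (bigL G ≠ 2 * smallL G → accept.eval n (Cmd.auction.eval n ρ (input G).mem) ρ = 0) := by
  have h := (represents_input G).auction (ρ := ρ)
  generalize Cmd.auction.eval n ρ (input G).mem = m at h
  have key : Holds n m ρ (Expr.and good (all 1 (imp (free 1 4) (Expr.and (owns false) (owns true)))))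
      ↔ bigL G = 2 * smallL G := by
    rw [bigL_eq_two_mul_smallL_iff, holds_and, holds_good h.graph]
    refine and_congr_right fun hg => ?_
    rw [hg.hasSystem_iff]
    rcases Nat.eq_zero_or_pos n with rfl | hn
    · simp
    · have : Nonempty (Fin n) := ⟨⟨0, hn⟩⟩
      -- There are `n` objects and `2n` bidders, and `2n² < 3n²` because `n > 0`.
      rw [← Auction.iterate_sweep_iff (E := Usable G) (need := fun l => Free G l.1)
        (fun l f hl => hl.1) mem_bidders (List.mem_finRange) (T := 3 * n * n) (by simp; nlinarith)]
      simp only [holds_all, holds_imp, holds_and, Prod.forall, Bool.forall_bool]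
      refine forall_congr' fun v => ?_
      rw [holds_free (a := v) h.graph (by simp) (by simp) (by simp),
        h.holds_owns (k := v) (by simp), h.holds_owns (k := v) (by simp)]
      tauto
  simp only [accept, eval]
  unfold Holds at key
  exact ⟨fun hL => by simp [key.2 hL], fun hL => by simpa using mt key.1 hL⟩

end Auction

end RAM

theorem mainTheorem3 :
    RAM.DecidableInPolyTime fun (n : ℕ) (G : SimpleGraph (Fin n)) =>
      MatchingPairs.bigL G = 2 * MatchingPairs.smallL G := by
  refine ⟨RAM.mainProgram RAM.Cmd.auction RAM.Expr.accept,
    RAM.Cmd.auction.cost + RAM.Expr.accept.cost + 2, fun n G => ?_⟩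
  obtain ⟨t, ht, hh, hr⟩ := RAM.mainProgram_spec RAM.Cmd.auction RAM.Expr.accept G
  have h := RAM.eval_accept (ρ := fun _ => 0) G
  exact ⟨t, ht, hh, fun hQ => hr.trans (h.1 hQ), fun hQ => hr.trans (h.2 hQ)⟩
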